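/- A group is sofic if it is isomorphic to a subgroup of a metric ultraproduct $\prod_{\alpha\in A}(S_{n(\alpha)},d_{\mathrm{hamm}})/\mathcal U$ of finite symmetric groups with the normalized Hamming metrics along an ultrafilter $\mathcal U$ on a set $A$. A group $G$ is $\aleph_0$-existentially closed if every finite system of equations $w=1$ and inequations $w\neq 1$ with coefficients in $G$ that has a solution in some group containing $G$ has a solution in $G$. A non-sofic group is $\omega$-non-sofic if it has an infinite strictly descending chain $H_0>H_1>H_2>\cdots$ of non-sofic subgroups. (1) If a non-sofic group exists, then there exists a countable $\aleph_0$-existentially closed non-sofic group. (2) Let $G$ be any countable $\aleph_0$-existentially closed non-sofic group. Then there is a family $(A_q)_{q\in\mathbb Q}$ of finitely generated non-abelian free subgroups of $G$ whose centralizers form a chain of order type $(\mathbb Q,\le)$, that is, $C_G(A_q)\le C_G(A_r)$ if and only if $q\le r$, for all $q,r\in\mathbb Q$, and each $C_G(A_q)$ is isomorphic to $G$, hence non-sofic. In particular, $G$ is $\omega$-non-sofic. -/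

import Mathlib

open Filter Topology

universe u v

/-- The normalized Hamming distance on the symmetric group `S_n`: the proportion of points of
`{0, …, n - 1}` at which the two permutations differ (it is `0` on the trivial group `S_0`). -/
noncomputable def hammingNormDist {n : ℕ} (σ τ : Equiv.Perm (Fin n)) : ℝ :=
  (hammingDist (σ : Fin n → Fin n) (τ : Fin n → Fin n) : ℝ) / n

theorem hammingNormDist_nonneg {n : ℕ} (σ τ : Equiv.Perm (Fin n)) : 0 ≤ hammingNormDist σ τ := by
  unfold hammingNormDist; positivity

theorem hammingNormDist_self {n : ℕ} (σ : Equiv.Perm (Fin n)) : hammingNormDist σ σ = 0 := by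
  simp [hammingNormDist]

theorem hammingNormDist_triangle {n : ℕ} (σ τ ρ : Equiv.Perm (Fin n)) :
    hammingNormDist σ ρ ≤ hammingNormDist σ τ + hammingNormDist τ ρ := by
  unfold hammingNormDist
  rw [← add_div]
  gcongr
  exact_mod_cast hammingDist_triangle _ _ _

theorem hammingNormDist_comm {n : ℕ} (σ τ : Equiv.Perm (Fin n)) :
    hammingNormDist σ τ = hammingNormDist τ σ := by
  simp [hammingNormDist, hammingDist_comm]

theorem hammingNormDist_mul_left {n : ℕ} (ρ σ τ : Equiv.Perm (Fin n)) :
    hammingNormDist (ρ * σ) (ρ * τ) = hammingNormDist σ τ := by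
  simp [hammingNormDist, hammingDist]

theorem hammingNormDist_mul_right {n : ℕ} (ρ σ τ : Equiv.Perm (Fin n)) :
    hammingNormDist (σ * ρ) (τ * ρ) = hammingNormDist σ τ := by
  unfold hammingNormDist hammingDist
  congr 2
  refine Finset.card_bij (fun i _ => ρ i) (fun a ha => ?_) (fun a _ b _ h => ρ.injective h)
    (fun b hb => ⟨ρ.symm b, ?_, ρ.apply_symm_apply b⟩)
  · exact Finset.mem_filter.2 ⟨Finset.mem_univ _, (Finset.mem_filter.1 ha).2⟩
  · refine Finset.mem_filter.2 ⟨Finset.mem_univ _, ?_⟩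
    simpa using (Finset.mem_filter.1 hb).2

/-- The subgroup of the product `∏ a, S_{n a}` of those families whose Hamming distance to the
identity tends to `0` along the ultrafilter `U`. -/
def hammingNull {A : Type u} (U : Ultrafilter A) (n : A → ℕ) :
    Subgroup (∀ a, Equiv.Perm (Fin (n a))) where
  carrier := {x | Tendsto (fun a => hammingNormDist (x a) 1) (U : Filter A) (𝓝 0)}
  one_mem' := by simp [hammingNormDist_self]
  mul_mem' := by
    intro x y hx hy
    have h := Tendsto.add hx hy
    rw [add_zero] at h
    refine squeeze_zero (fun a => hammingNormDist_nonneg _ _) (fun a => ?_) h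
    have h1 := hammingNormDist_triangle (x a * y a) (1 * y a) 1
    rw [hammingNormDist_mul_right, one_mul] at h1
    exact h1
  inv_mem' := by
    intro x hx
    refine Tendsto.congr (fun a => ?_) hx
    have h1 := hammingNormDist_mul_left (x a)⁻¹ (x a) 1
    rw [inv_mul_cancel, mul_one, hammingNormDist_comm] at h1
    exact h1.symm

instance hammingNull_normal {A : Type u} (U : Ultrafilter A) (n : A → ℕ) :
    (hammingNull U n).Normal where
  conj_mem := by
    intro x hx g
    refine Tendsto.congr (fun a => ?_) hx
    have h1 := hammingNormDist_mul_right (g a)⁻¹ (g a * x a) (g a * 1)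
    rw [hammingNormDist_mul_left, mul_one, mul_inv_cancel] at h1
    exact h1.symm

/-- The metric ultraproduct of the finite symmetric groups `S_{n a}`, equipped with the normalized
Hamming metrics, along the ultrafilter `U`. -/
abbrev HammingUltraproduct {A : Type u} (U : Ultrafilter A) (n : A → ℕ) : Type u :=
  (∀ a, Equiv.Perm (Fin (n a))) ⧸ hammingNull U n

/-- A group is sofic if it is isomorphic to a subgroup of a metric ultraproduct of finite symmetric
groups with their normalized Hamming metrics. -/
def IsSofic (G : Type u) [Group G] : Prop :=
  ∃ (A : Type u) (U : Ultrafilter A) (n : A → ℕ) (f : G →* HammingUltraproduct U n),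
    Function.Injective f

/-- A non-sofic group is `ω`-non-sofic if it has an (infinite) strictly descending chain
`H 0 > H 1 > H 2 > …` of non-sofic subgroups. -/
def IsOmegaNonSofic (G : Type u) [Group G] : Prop :=
  ¬ IsSofic G ∧ ∃ H : ℕ → Subgroup G, StrictAnti H ∧ ∀ i, ¬ IsSofic (H i)

/-- The words in `m` variables with coefficients in `G`: elements of the free product of `G` with
the free group on `m` letters. -/
abbrev WordOver (G : Type u) [Group G] (m : ℕ) : Type u :=
  Monoid.Coprod G (FreeGroup (Fin m))

/-- The value of a word over `G` in a group `K`, where the coefficients are mapped to `K` by `φ` and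
the variables are replaced by `x`. -/
def WordOver.eval {G : Type u} [Group G] {m : ℕ} {K : Type u} [Group K] (φ : G →* K)
    (x : Fin m → K) : WordOver G m →* K :=
  Monoid.Coprod.lift φ (FreeGroup.lift x)

/-- `x` is a solution in `K` of the system consisting of the equations `w = 1`, `w ∈ E`, and the
inequations `w ≠ 1`, `w ∈ I`. -/
def IsSolution {G : Type u} [Group G] {m : ℕ} (E I : Finset (WordOver G m)) {K : Type u} [Group K]
    (φ : G →* K) (x : Fin m → K) : Prop :=
  (∀ w ∈ E, WordOver.eval φ x w = 1) ∧ ∀ w ∈ I, WordOver.eval φ x w ≠ 1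

/-- `G` is `ℵ₀`-existentially closed: every system of finitely many equations and inequations with
coefficients in `G` that has a solution in some group `K` containing `G` has a solution in `G`.
(Overgroups in the universe of `G` suffice: `G` and a solution generate a subgroup of the overgroup
of cardinality at most `max |G| ℵ₀`.) -/
def IsAlephNullExistentiallyClosed (G : Type u) [Group G] : Prop :=
  ∀ (m : ℕ) (E I : Finset (WordOver G m)),
    (∃ (K : Type u) (_ : Group K) (φ : G →* K),
      Function.Injective φ ∧ ∃ x : Fin m → K, IsSolution E I φ x) →
    ∃ x : Fin m → G, IsSolution E I (MonoidHom.id G) x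

/-!
Soficity is a local property. By passing to diagonal actions on tuples, which raises the proportion
of fixed points to a power, the distance of a nontrivial element from the identity can be bounded
below by a constant, so that `IsSofic` becomes a statement about finite subsets
(`IsSofic.hasSoficApproximations`, `HasSoficApproximations.isSofic`). Hence a non-sofic group has a
countable non-sofic subgroup, which can be moved to any universe. Every countable group embeds in a
countable `ℵ₀`-existentially closed group, the union of a sequence of overgroups, each a countable
subgroup of an amalgam that solves all the solvable systems over the preceding group. This gives the
first part.

For the second part, let `G` be countable and `ℵ₀`-existentially closed. HNN extensions show that
any two embeddings in `G` of a finitely generated group are conjugate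
(`IsAlephNullExistentiallyClosed.exists_conj`), and the left regular representation shows that
`C(A) ≤ C(B)` only if `B ≤ A`, for finitely generated `A ≠ 1`
(`IsAlephNullExistentiallyClosed.le_of_centralizer_le`). A finite system of equations and
inequations can force a tuple to generate a free group: it describes a game of ping-pong that is
played by finitely generated subgroups, and can be solved in the symmetric group of a countable
set. Therefore every finitely generated subgroup of `G` commutes with a free subgroup of rank `n`
(`IsAlephNullExistentiallyClosed.exists_freeGroup_commute`). If `A` is finitely generated and lies
in a free subgroup of `G`, and contains two basis elements of it, then `A` has trivial center, and
it follows that `C(A)` has the same finitely generated subgroups as `G` and that isomorphic ones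
among them are conjugate in `C(A)`. A back-and-forth argument then yields `C(A) ≃* G`
(`IsConjHomogeneous.nonempty_mulEquiv`).

It remains to find a chain of order type `ℚ` among the finitely generated subgroups of a free group
of rank three. The relation "`B ≤ A`, and `A` contains a free product of `B` and `⟨z⟩`" is a strict
order, and it is dense: the subgroup generated by `B` and `z * y * z⁻¹`, with `y` primitive in `B`,
lies strictly between (`Subgroup.IsFreelyBelow.exists_between`).
-/

/-! ### Soficity as a local property -/

theorem one_sub_hammingNormDist {n : ℕ} (hn : n ≠ 0) (σ τ : Equiv.Perm (Fin n)) :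
    1 - hammingNormDist σ τ = (Finset.univ.filter fun i => σ i = τ i).card / (n : ℝ) := by
  have h := Finset.card_filter_add_card_filter_not (s := (Finset.univ : Finset (Fin n)))
    (fun i => σ i = τ i)
  have h' : ((Finset.univ.filter fun i => σ i = τ i).card : ℝ) +
      (hammingDist (σ : Fin n → Fin n) (τ : Fin n → Fin n) : ℝ) = n := by
    rw [Finset.card_univ, Fintype.card_fin] at h
    exact_mod_cast h
  have hn' : (n : ℝ) ≠ 0 := by exact_mod_cast hn
  rw [hammingNormDist, eq_div_iff hn', sub_mul, div_mul_cancel₀ _ hn']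
  linarith

/-- The diagonal action of a permutation of `Fin n` on the `k`-tuples of elements of `Fin n`,
which are identified with the elements of `Fin (n ^ k)`. -/
def permTuple {n : ℕ} (k : ℕ) (σ : Equiv.Perm (Fin n)) : Equiv.Perm (Fin (n ^ k)) :=
  finFunctionFinEquiv.permCongr (Equiv.piCongrRight fun _ : Fin k => σ)

theorem permTuple_apply {n k : ℕ} (σ : Equiv.Perm (Fin n)) (f : Fin k → Fin n) :
    permTuple k σ (finFunctionFinEquiv f) = finFunctionFinEquiv (fun i => σ (f i)) := by
  simp only [permTuple, Equiv.permCongr_apply, Equiv.symm_apply_apply]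
  rfl

theorem permTuple_mul {n k : ℕ} (σ τ : Equiv.Perm (Fin n)) :
    permTuple k (σ * τ) = permTuple k σ * permTuple k τ := by
  ext1 x
  obtain ⟨f, rfl⟩ := finFunctionFinEquiv.surjective x
  simp only [Equiv.Perm.mul_apply, permTuple_apply]

theorem permTuple_one {n k : ℕ} : permTuple k (1 : Equiv.Perm (Fin n)) = 1 := by
  ext1 x
  obtain ⟨f, rfl⟩ := finFunctionFinEquiv.surjective x
  simp only [Equiv.Perm.one_apply, permTuple_apply]

/-- Passing to the diagonal action on `k`-tuples raises the proportion of points of agreement to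
its `k`-th power. -/
theorem one_sub_hammingNormDist_permTuple {n : ℕ} (hn : n ≠ 0) (k : ℕ)
    (σ τ : Equiv.Perm (Fin n)) :
    1 - hammingNormDist (permTuple k σ) (permTuple k τ) = (1 - hammingNormDist σ τ) ^ k := by
  rw [one_sub_hammingNormDist (pow_ne_zero k hn), one_sub_hammingNormDist hn, div_pow]
  push_cast
  congr 1
  rw [← Nat.cast_pow]
  congr 1
  have : (Finset.univ.filter fun i => permTuple k σ i = permTuple k τ i) =
      (Fintype.piFinset fun _ : Fin k => Finset.univ.filter fun i => σ i = τ i).map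
        finFunctionFinEquiv.toEmbedding := by
    ext x
    obtain ⟨f, rfl⟩ := finFunctionFinEquiv.surjective x
    simp [permTuple_apply, funext_iff]
  rw [this, Finset.card_map, Fintype.card_piFinset_const]

theorem hammingNormDist_le_one {n : ℕ} (σ τ : Equiv.Perm (Fin n)) : hammingNormDist σ τ ≤ 1 := by
  rcases eq_or_ne n 0 with rfl | hn
  · simp [hammingNormDist]
  · have := one_sub_hammingNormDist hn σ τ
    have h2 : (0 : ℝ) ≤ (Finset.univ.filter fun i => σ i = τ i).card / (n : ℝ) := by positivity
    linarith

/-- The local form of soficity: every finite subset `F` of `G` has, for each `ε > 0`, a map to a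
finite symmetric group that is multiplicative on `F` up to `ε` and moves the nontrivial elements of
`F` to distance at least `1 / 2` from the identity. The bound `1 / 2` depends neither on `F` nor on
the elements. -/
def HasSoficApproximations (G : Type u) [Group G] : Prop :=
  ∀ (F : Finset G) (ε : ℝ), 0 < ε → ∃ (n : ℕ) (f : G → Equiv.Perm (Fin n)),
    (∀ g ∈ F, ∀ h ∈ F, hammingNormDist (f g * f h) (f (g * h)) ≤ ε) ∧
      ∀ g ∈ F, g ≠ 1 → 1 / 2 ≤ hammingNormDist (f g) 1

theorem HasSoficApproximations.of_injective {G : Type u} {H : Type v} [Group G] [Group H]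
    (hH : HasSoficApproximations H) (i : G →* H) (hi : Function.Injective i) :
    HasSoficApproximations G := by
  classical
  intro F ε hε
  obtain ⟨n, f, h1, h2⟩ := hH (F.image i) ε hε
  refine ⟨n, f ∘ i, fun g hg h hh => ?_, fun g hg hg1 => ?_⟩
  · simpa using h1 _ (Finset.mem_image_of_mem i hg) _ (Finset.mem_image_of_mem i hh)
  · exact h2 _ (Finset.mem_image_of_mem i hg) ((map_ne_one_iff i hi).2 hg1)

/-- A group has sofic approximations as soon as its finitely generated subgroups have. -/
theorem HasSoficApproximations.of_closure {G : Type u} [Group G]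
    (h : ∀ F : Finset G, HasSoficApproximations (Subgroup.closure (F : Set G))) :
    HasSoficApproximations G := by
  classical
  intro F ε hε
  obtain ⟨n, f, h1, h2⟩ := h F (Finset.univ.image fun x : F =>
    (⟨x, Subgroup.subset_closure x.2⟩ : Subgroup.closure (F : Set G))) ε hε
  have hmem : ∀ g ∈ F, g ∈ Subgroup.closure (F : Set G) := fun g hg => Subgroup.subset_closure hg
  refine ⟨n, fun g => if hg : g ∈ Subgroup.closure (F : Set G) then f ⟨g, hg⟩ else 1,
    fun g hg g' hg' => ?_, fun g hg hg1 => ?_⟩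
  · beta_reduce
    rw [dif_pos (hmem g hg), dif_pos (hmem g' hg'), dif_pos (mul_mem (hmem g hg) (hmem g' hg'))]
    exact h1 _ (Finset.mem_image.2 ⟨⟨g, hg⟩, Finset.mem_univ _, rfl⟩) _
      (Finset.mem_image.2 ⟨⟨g', hg'⟩, Finset.mem_univ _, rfl⟩)
  · beta_reduce
    rw [dif_pos (hmem g hg)]
    refine h2 _ (Finset.mem_image.2 ⟨⟨g, hg⟩, Finset.mem_univ _, rfl⟩) ?_
    simpa [Subtype.ext_iff] using hg1

theorem mk_eq_mk_iff_tendsto_hammingNormDist {A : Type u} (U : Ultrafilter A) (n : A → ℕ)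
    (x y : ∀ a, Equiv.Perm (Fin (n a))) :
    (x : HammingUltraproduct U n) = (y : HammingUltraproduct U n) ↔
      Tendsto (fun a => hammingNormDist (x a) (y a)) (U : Filter A) (𝓝 0) := by
  rw [QuotientGroup.eq]
  change Tendsto (fun a => hammingNormDist ((x a)⁻¹ * y a) 1) _ _ ↔ _
  refine iff_of_eq (congrArg (fun f => Tendsto f (U : Filter A) (𝓝 0)) (funext fun a => ?_))
  rw [← hammingNormDist_mul_left (x a), mul_inv_cancel_left, mul_one, hammingNormDist_comm]

/-- A lift of the embedding in the ultraproduct is approximately multiplicative along `U`, but only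
bounds the distances to the identity below by a constant depending on the finite set; passing to
`k`-tuples, for `k` large, replaces this constant by `1 / 2`. -/
theorem IsSofic.hasSoficApproximations {G : Type u} [Group G] (hG : IsSofic G) :
    HasSoficApproximations G := by
  classical
  obtain ⟨A, U, n, f, hf⟩ := hG
  intro F ε hε
  have hout : ∀ g, ((f g).out : HammingUltraproduct U n) = f g := fun g => Quotient.out_eq' _
  set φ : G → ∀ a, Equiv.Perm (Fin (n a)) := fun g => (f g).out with hφ
  have hmul : ∀ g h, Tendsto (fun a => hammingNormDist (φ g a * φ h a) (φ (g * h) a))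
      (U : Filter A) (𝓝 0) := by
    intro g h
    refine (mk_eq_mk_iff_tendsto_hammingNormDist U n (φ g * φ h) (φ (g * h))).1 ?_
    rw [QuotientGroup.mk_mul, hout, hout, hout, map_mul]
  have hne : ∀ g, g ≠ 1 → ∃ δ > 0, ∀ᶠ a in (U : Filter A), δ ≤ hammingNormDist (φ g a) 1 := by
    intro g hg
    have h1 : ¬ Tendsto (fun a => hammingNormDist (φ g a) 1) (U : Filter A) (𝓝 0) := by
      intro h
      have := (mk_eq_mk_iff_tendsto_hammingNormDist U n (φ g) 1).2 h
      rw [hout, QuotientGroup.mk_one] at this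
      exact hg ((map_eq_one_iff f hf).1 this)
    by_contra! hcon
    refine h1 (Metric.tendsto_nhds.2 fun δ hδ => ?_)
    filter_upwards [hcon δ hδ] with a ha
    rw [Real.dist_eq, sub_zero, abs_of_nonneg (hammingNormDist_nonneg _ _)]
    exact ha
  choose! δ hδ hδ' using hne
  -- a lower bound, valid on all of `F`, for the distances to the identity
  obtain ⟨δ₀, hδ₀, hδ₀1, hle⟩ : ∃ δ₀ > 0, δ₀ ≤ 1 ∧ ∀ g ∈ F, g ≠ 1 → δ₀ ≤ δ g := by
    clear hε
    induction F using Finset.induction_on with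
    | empty => exact ⟨1, one_pos, le_rfl, by simp⟩
    | insert g F _ ih =>
      obtain ⟨δ₀, h1, h2, h3⟩ := ih
      by_cases hg : g = 1
      · refine ⟨δ₀, h1, h2, fun g' hg' hg'1 => ?_⟩
        rcases Finset.mem_insert.1 hg' with rfl | h
        · exact absurd hg hg'1
        · exact h3 _ h hg'1
      · refine ⟨min δ₀ (δ g), lt_min h1 (hδ g hg), (min_le_left _ _).trans h2,
          fun g' hg' hg'1 => ?_⟩
        rcases Finset.mem_insert.1 hg' with rfl | h
        · exact min_le_right _ _
        · exact (min_le_left _ _).trans (h3 _ h hg'1)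
  obtain ⟨k, hk⟩ := exists_pow_lt_of_lt_one (show (0 : ℝ) < 1 / 2 by norm_num)
    (show 1 - δ₀ < 1 by linarith)
  have hev : ∀ᶠ a in (U : Filter A),
      (∀ g ∈ F, ∀ h ∈ F, hammingNormDist (φ g a * φ h a) (φ (g * h) a) ≤ ε / (k + 1)) ∧
        ∀ g ∈ F, g ≠ 1 → δ g ≤ hammingNormDist (φ g a) 1 := by
    refine Eventually.and ?_ ?_
    · rw [eventually_all_finset]
      intro g _
      rw [eventually_all_finset]
      intro h _
      exact (hmul g h).eventually_le_const (by positivity)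
    · rw [eventually_all_finset]
      intro g _
      by_cases hg : g = 1
      · simp [hg]
      · filter_upwards [hδ' g hg] with a ha _ using ha
  obtain ⟨a, ha1, ha2⟩ := hev.exists
  rcases eq_or_ne (n a) 0 with hn | hn
  · have hF : ∀ g ∈ F, g = 1 := by
      intro g hg
      by_contra hg1
      have h0 : hammingNormDist (φ g a) 1 = 0 := by simp [hammingNormDist, hn]
      have := ha2 g hg hg1
      rw [h0] at this
      exact absurd (hδ g hg1) (not_lt.2 this)
    exact ⟨0, fun _ => 1, fun _ _ _ _ => by simpa [hammingNormDist_self] using hε.le,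
      fun g hg hg1 => absurd (hF g hg) hg1⟩
  refine ⟨n a ^ k, fun g => permTuple k (φ g a), fun g hg h hh => ?_, fun g hg hg1 => ?_⟩
  · rw [← permTuple_mul]
    have h1 := one_sub_hammingNormDist_permTuple hn k (φ g a * φ h a) (φ (g * h) a)
    have h2 := one_add_mul_le_pow (a := -hammingNormDist (φ g a * φ h a) (φ (g * h) a))
      (by linarith [hammingNormDist_le_one (φ g a * φ h a) (φ (g * h) a)]) k
    rw [← sub_eq_add_neg] at h2
    have h3 := ha1 g hg h hh
    rw [le_div_iff₀ (by positivity)] at h3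
    nlinarith [hammingNormDist_nonneg (φ g a * φ h a) (φ (g * h) a)]
  · have h1 := one_sub_hammingNormDist_permTuple hn k (φ g a) 1
    rw [permTuple_one] at h1
    have h2 : (1 - hammingNormDist (φ g a) 1) ^ k ≤ (1 - δ₀) ^ k :=
      pow_le_pow_left₀ (by linarith [hammingNormDist_le_one (φ g a) 1])
        (by linarith [hle g hg hg1, ha2 g hg hg1]) k
    linarith

theorem HasSoficApproximations.isSofic {G : Type u} [Group G] (hG : HasSoficApproximations G) :
    IsSofic G := by
  classical
  choose n f hmul hne using fun a : Finset G × ℕ =>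
    hG a.1 (1 / ((a.2 : ℝ) + 1)) Nat.one_div_pos_of_nat
  have hF : ∀ g : G, ∀ᶠ a in (atTop : Filter (Finset G × ℕ)), g ∈ a.1 := fun g =>
    (eventually_ge_atTop (({g} : Finset G), 0)).mono fun a ha => ha.1 (Finset.mem_singleton_self g)
  let U : Ultrafilter (Finset G × ℕ) := Ultrafilter.of atTop
  have hU : (U : Filter (Finset G × ℕ)) ≤ atTop := Ultrafilter.of_le atTop
  let φ : G →* HammingUltraproduct U n := MonoidHom.mk'
    (fun g => ((fun a => f a g : ∀ a, Equiv.Perm (Fin (n a))) : HammingUltraproduct U n)) (by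
      intro g h
      rw [← QuotientGroup.mk_mul, mk_eq_mk_iff_tendsto_hammingNormDist]
      refine Tendsto.mono_left ?_ hU
      have hlim : Tendsto (fun a : Finset G × ℕ => 1 / ((a.2 : ℝ) + 1)) atTop (𝓝 0) := by
        rw [← prod_atTop_atTop_eq]
        exact tendsto_one_div_add_atTop_nhds_zero_nat.comp tendsto_snd
      refine squeeze_zero' (Eventually.of_forall fun a => hammingNormDist_nonneg _ _) ?_ hlim
      filter_upwards [hF g, hF h] with a hg hh
      rw [hammingNormDist_comm]
      exact hmul a g hg h hh)
  refine ⟨Finset G × ℕ, U, n, φ, (injective_iff_map_eq_one φ).2 fun g hg => ?_⟩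
  by_contra hg1
  have h0 := (mk_eq_mk_iff_tendsto_hammingNormDist U n (fun a => f a g) 1).1 hg
  have h1 : ∀ᶠ a in (U : Filter (Finset G × ℕ)), 1 / 2 ≤ hammingNormDist (f a g) 1 :=
    ((hF g).filter_mono hU).mono fun a ha => hne a g ha hg1
  have := ge_of_tendsto h0 h1
  norm_num at this

theorem IsSofic.of_injective {G : Type u} {H : Type v} [Group G] [Group H] (hH : IsSofic H)
    (i : G →* H) (hi : Function.Injective i) : IsSofic G :=
  (hH.hasSoficApproximations.of_injective i hi).isSofic

/-! ### Countable existentially closed overgroups -/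

theorem Set.Countable.subgroup_closure {G : Type*} [Group G] {s : Set G} (hs : s.Countable) :
    Countable (Subgroup.closure s) := by
  have := hs.to_subtype
  rw [← Subtype.range_coe (s := s), ← FreeGroup.range_lift_eq_closure]
  exact (MonoidHom.rangeRestrict_surjective _).countable

theorem WordOver.eval_map {G H K : Type v} [Group G] [Group H] [Group K] {m : ℕ} (j : G →* H)
    (φ : H →* K) (x : Fin m → K) (w : WordOver G m) :
    WordOver.eval φ x (Monoid.Coprod.map j (MonoidHom.id _) w) =
      WordOver.eval (φ.comp j) x w := by
  refine DFunLike.congr_fun (f := (WordOver.eval φ x).comp (Monoid.Coprod.map j (.id _))) ?_ w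
  ext <;> simp [WordOver.eval]

theorem WordOver.map_eval {G K L : Type v} [Group G] [Group K] [Group L] {m : ℕ}
    (φ : G →* K) (ψ : K →* L) (x : Fin m → K) (w : WordOver G m) :
    ψ (WordOver.eval φ x w) = WordOver.eval (ψ.comp φ) (ψ ∘ x) w := by
  refine DFunLike.congr_fun (f := ψ.comp (WordOver.eval φ x)) ?_ w
  ext <;> simp [WordOver.eval]

theorem IsSolution.map {G K L : Type v} [Group G] [Group K] [Group L] {m : ℕ}
    {E I : Finset (WordOver G m)} {φ : G →* K} {x : Fin m → K} (h : IsSolution E I φ x)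
    {ψ : K →* L} (hψ : Function.Injective ψ) : IsSolution E I (ψ.comp φ) (ψ ∘ x) := by
  refine ⟨fun w hw => ?_, fun w hw => ?_⟩
  · rw [← WordOver.map_eval, h.1 w hw, map_one]
  · rw [← WordOver.map_eval]
    exact (map_ne_one_iff ψ hψ).2 (h.2 w hw)

/-- Systems of equations and inequations over `G` that can be solved in an overgroup. -/
def IsSolvableSystem (G : Type v) [Group G]
    (s : Σ m : ℕ, Finset (WordOver G m) × Finset (WordOver G m)) : Prop :=
  ∃ (K : Type v) (_ : Group K) (φ : G →* K),
    Function.Injective φ ∧ ∃ x : Fin s.1 → K, IsSolution s.2.1 s.2.2 φ x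

instance {M N : Type*} [Monoid M] [Monoid N] [Countable M] [Countable N] :
    Countable (Monoid.Coprod M N) :=
  (Con.mk'_surjective (c := Monoid.coprodCon M N)).countable

/-- Amalgamating over `G` one overgroup for each solvable system yields an overgroup in which all
of these systems have solutions; the base and the solutions generate a countable subgroup. -/
theorem exists_countable_overgroup_solving (G : Type v) [Group G] [Countable G] :
    ∃ (L : Type v) (_ : Group L) (φ : G →* L), Countable L ∧ Function.Injective φ ∧
      ∀ s, IsSolvableSystem G s → ∃ x : Fin s.1 → L, IsSolution s.2.1 s.2.2 φ x := by
  classical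
  choose K hK φ hφ x hx using fun s : {s // IsSolvableSystem G s} => s.2
  let P := Monoid.PushoutI φ
  let S : Set P := Set.range (Monoid.PushoutI.base φ) ∪
    ⋃ s : {s // IsSolvableSystem G s}, Set.range fun i => Monoid.PushoutI.of (φ := φ) s (x s i)
  have hS : S.Countable := (Set.countable_range _).union
    (Set.countable_iUnion fun s => Set.countable_range _)
  let ψ : G →* Subgroup.closure S := (Monoid.PushoutI.base φ).codRestrict _
    fun g => Subgroup.subset_closure (Or.inl ⟨g, rfl⟩)
  refine ⟨Subgroup.closure S, inferInstance, ψ, hS.subgroup_closure, fun a b hab => ?_,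
    fun s hs => ?_⟩
  · exact Monoid.PushoutI.base_injective hφ (congrArg Subtype.val hab)
  · let y : Fin s.1 → Subgroup.closure S := fun i =>
      ⟨Monoid.PushoutI.of (φ := φ) ⟨s, hs⟩ (x ⟨s, hs⟩ i), Subgroup.subset_closure
        (Or.inr (Set.mem_iUnion.2 ⟨⟨s, hs⟩, i, rfl⟩))⟩
    have hsol := (hx ⟨s, hs⟩).map (Monoid.PushoutI.of_injective hφ ⟨s, hs⟩)
    rw [Monoid.PushoutI.of_comp_eq_base] at hsol
    have hval : ∀ w, ((WordOver.eval ψ y w : Subgroup.closure S) : P) =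
        WordOver.eval (Monoid.PushoutI.base φ)
          (Monoid.PushoutI.of (φ := φ) ⟨s, hs⟩ ∘ x ⟨s, hs⟩) w := fun w =>
      WordOver.map_eval ψ (Subgroup.closure S).subtype y w
    refine ⟨y, fun w hw => Subtype.ext ?_, fun w hw h => ?_⟩
    · rw [hval]; exact hsol.1 w hw
    · exact hsol.2 w hw ((hval w).symm.trans (congrArg Subtype.val h))

/-- A countable group, bundled; the stages of the construction of an existentially closed group. -/
structure CountableGroup : Type (v + 1) where
  carrier : Type v
  [group : Group carrier]
  [countable : Countable carrier]

namespace CountableGroup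

attribute [instance] CountableGroup.group CountableGroup.countable

/-- A countable overgroup of `G` in which all solvable systems over `G` are solved. -/
noncomputable def next (G : CountableGroup.{v}) : CountableGroup.{v} :=
  @mk (exists_countable_overgroup_solving G.carrier).choose
    (exists_countable_overgroup_solving G.carrier).choose_spec.choose
    (exists_countable_overgroup_solving G.carrier).choose_spec.choose_spec.choose_spec.1

/-- The inclusion of `G` in the overgroup `G.next`. -/
noncomputable def toNext (G : CountableGroup.{v}) : G.carrier →* G.next.carrier :=
  (exists_countable_overgroup_solving G.carrier).choose_spec.choose_spec.choose

theorem toNext_injective (G : CountableGroup.{v}) : Function.Injective G.toNext :=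
  (exists_countable_overgroup_solving G.carrier).choose_spec.choose_spec.choose_spec.2.1

theorem exists_isSolution_toNext (G : CountableGroup.{v}) (s) (hs : IsSolvableSystem G.carrier s) :
    ∃ x : Fin s.1 → G.next.carrier, IsSolution s.2.1 s.2.2 G.toNext x :=
  (exists_countable_overgroup_solving G.carrier).choose_spec.choose_spec.choose_spec.2.2 s hs

/-- The `n`-th stage over `G`. -/
noncomputable def stage (G : CountableGroup.{v}) : ℕ → CountableGroup.{v}
  | 0 => G
  | n + 1 => (stage G n).next

/-- The inclusion of the `m`-th stage in the `n`-th stage, for `m ≤ n`. -/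
noncomputable def stageMap (G : CountableGroup.{v}) (m n : ℕ) (h : m ≤ n) :
    (G.stage m).carrier →* (G.stage n).carrier :=
  Nat.leRecOn (C := fun n => (G.stage m).carrier →* (G.stage n).carrier) h
    (fun {k} g => (G.stage k).toNext.comp g) (MonoidHom.id _)

theorem stageMap_self (G : CountableGroup.{v}) (n : ℕ) :
    G.stageMap n n le_rfl = MonoidHom.id _ := Nat.leRecOn_self _

theorem stageMap_succ (G : CountableGroup.{v}) {m n : ℕ} (h : m ≤ n) :
    G.stageMap m (n + 1) (h.trans n.le_succ) = (G.stage n).toNext.comp (G.stageMap m n h) :=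
  Nat.leRecOn_succ h _

theorem stageMap_stageMap (G : CountableGroup.{v}) {m n k : ℕ} (h : m ≤ n) (h' : n ≤ k)
    (x : (G.stage m).carrier) :
    G.stageMap n k h' (G.stageMap m n h x) = G.stageMap m k (h.trans h') x := by
  induction k, h' using Nat.le_induction with
  | base => rw [stageMap_self]; rfl
  | succ k h' ih =>
    rw [stageMap_succ G h', stageMap_succ G (h.trans h')]
    exact congrArg (G.stage k).toNext ih

theorem stageMap_injective (G : CountableGroup.{v}) {m n : ℕ} (h : m ≤ n) :
    Function.Injective (G.stageMap m n h) := by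
  induction n, h using Nat.le_induction with
  | base => rw [stageMap_self]; exact Function.injective_id
  | succ n h ih =>
    rw [stageMap_succ G h]
    exact (G.stage n).toNext_injective.comp ih

theorem exists_isSolution_stageMap (G : CountableGroup.{v}) {n m : ℕ}
    {E I : Finset (WordOver (G.stage n).carrier m)}
    (h : IsSolvableSystem (G.stage n).carrier ⟨m, E, I⟩) :
    ∃ y : Fin m → (G.stage (n + 1)).carrier, IsSolution E I (G.stageMap n (n + 1) n.le_succ) y := by
  rw [stageMap_succ G le_rfl, stageMap_self]
  exact (G.stage n).exists_isSolution_toNext ⟨m, E, I⟩ h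

instance (G : CountableGroup.{v}) :
    DirectedSystem (fun n => (G.stage n).carrier) (fun m n h => G.stageMap m n h) :=
  ⟨fun n x => by rw [stageMap_self]; rfl, fun _ _ _ h h' x => G.stageMap_stageMap h h' x⟩

/-- The union of the stages over `G`. -/
abbrev limit (G : CountableGroup.{v}) : Type v :=
  DirectLimit (fun n => (G.stage n).carrier) G.stageMap

/-- The inclusion of the `n`-th stage in the union of the stages. -/
noncomputable def toLimit (G : CountableGroup.{v}) (n : ℕ) : (G.stage n).carrier →* G.limit :=
  MonoidHom.mk' (fun x => (Quotient.mk _ ⟨n, x⟩ : G.limit)) fun x y =>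
    (DirectLimit.mul_def (f := G.stageMap) n x y).symm

theorem toLimit_injective (G : CountableGroup.{v}) (n : ℕ) : Function.Injective (G.toLimit n) :=
  DirectLimit.mk_injective G.stageMap (fun _ _ h => G.stageMap_injective h) n

theorem toLimit_stageMap (G : CountableGroup.{v}) {m n : ℕ} (h : m ≤ n) (x) :
    G.toLimit n (G.stageMap m n h x) = G.toLimit m x :=
  (DirectLimit.mk_apply (F := fun n => (G.stage n).carrier) (f := G.stageMap) m n x h)

theorem exists_toLimit_eq (G : CountableGroup.{v}) (x : G.limit) : ∃ n y, G.toLimit n y = x := by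
  obtain ⟨n, y, rfl⟩ := DirectLimit.exists_eq_mk _ x
  exact ⟨n, y, rfl⟩

instance (G : CountableGroup.{v}) : Countable G.limit :=
  Function.Surjective.countable (f := fun p : Σ n, (G.stage n).carrier => G.toLimit p.1 p.2)
    fun x => let ⟨n, y, h⟩ := G.exists_toLimit_eq x; ⟨⟨n, y⟩, h⟩

/-- Finitely many words over the union of the stages have all their coefficients in one stage. -/
theorem exists_words (G : CountableGroup.{v}) {m : ℕ} (F : Finset (WordOver G.limit m)) :
    ∃ n, ∀ w ∈ F,
      w ∈ (Monoid.Coprod.map (G.toLimit n) (MonoidHom.id (FreeGroup (Fin m)))).range := by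
  classical
  have hmono : ∀ {n n' : ℕ}, n ≤ n' →
      (Monoid.Coprod.map (G.toLimit n) (MonoidHom.id (FreeGroup (Fin m)))).range ≤
        (Monoid.Coprod.map (G.toLimit n') (MonoidHom.id (FreeGroup (Fin m)))).range := by
    rintro n n' h _ ⟨w, rfl⟩
    refine ⟨Monoid.Coprod.map (G.stageMap n n' h) (MonoidHom.id _) w, ?_⟩
    rw [← MonoidHom.comp_apply, Monoid.Coprod.map_comp_map]
    congr 2
    ext x
    exact G.toLimit_stageMap h x
  have hone : ∀ w : WordOver G.limit m, ∃ n,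
      w ∈ (Monoid.Coprod.map (G.toLimit n) (MonoidHom.id (FreeGroup (Fin m)))).range := by
    intro w
    induction w using Monoid.Coprod.induction_on with
    | inl x =>
      obtain ⟨n, y, rfl⟩ := G.exists_toLimit_eq x
      exact ⟨n, Monoid.Coprod.inl y, by simp⟩
    | inr x => exact ⟨0, Monoid.Coprod.inr x, by simp⟩
    | mul x y hx hy =>
      obtain ⟨n, hx⟩ := hx
      obtain ⟨n', hy⟩ := hy
      exact ⟨max n n', mul_mem (hmono (le_max_left _ _) hx) (hmono (le_max_right _ _) hy)⟩
  choose n hn using hone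
  exact ⟨F.sup n, fun w hw => hmono (Finset.le_sup hw) (hn w)⟩

theorem isAlephNullExistentiallyClosed_limit (G : CountableGroup.{v}) :
    IsAlephNullExistentiallyClosed G.limit := by
  classical
  rintro m E I ⟨K, hK, φ, hφ, x, hx⟩
  obtain ⟨n, hn⟩ := G.exists_words (E ∪ I)
  choose! u hu using hn
  have hE : ∀ w ∈ E, Monoid.Coprod.map (G.toLimit n) (MonoidHom.id _) (u w) = w :=
    fun w hw => hu w (Finset.mem_union_left _ hw)
  have hI : ∀ w ∈ I, Monoid.Coprod.map (G.toLimit n) (MonoidHom.id _) (u w) = w :=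
    fun w hw => hu w (Finset.mem_union_right _ hw)
  obtain ⟨y, hy⟩ := G.exists_isSolution_stageMap (E := E.image u) (I := I.image u)
    ⟨K, hK, φ.comp (G.toLimit n), hφ.comp (G.toLimit_injective n), x, by
      refine ⟨fun w hw => ?_, fun w hw => ?_⟩ <;> obtain ⟨w, hw', rfl⟩ := Finset.mem_image.1 hw
      · rw [← WordOver.eval_map, hE w hw']; exact hx.1 w hw'
      · rw [← WordOver.eval_map, hI w hw']; exact hx.2 w hw'⟩
  have hcomp : (G.toLimit (n + 1)).comp (G.stageMap n (n + 1) n.le_succ) =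
      (MonoidHom.id _).comp (G.toLimit n) := by
    ext z
    exact G.toLimit_stageMap (Nat.le_succ n) z
  have hsol := hy.map (G.toLimit_injective (n + 1))
  rw [hcomp] at hsol
  refine ⟨G.toLimit (n + 1) ∘ y, fun w hw => ?_, fun w hw => ?_⟩
  · have := hsol.1 (u w) (Finset.mem_image_of_mem u hw)
    rwa [← WordOver.eval_map, hE w hw] at this
  · have := hsol.2 (u w) (Finset.mem_image_of_mem u hw)
    rwa [← WordOver.eval_map, hI w hw] at this

end CountableGroup

theorem exists_countable_isAlephNullExistentiallyClosed (G : Type v) [Group G] [Countable G] :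
    ∃ (L : Type v) (_ : Group L) (φ : G →* L), Countable L ∧ Function.Injective φ ∧
      IsAlephNullExistentiallyClosed L :=
  let S : CountableGroup.{v} := ⟨G⟩
  ⟨S.limit, inferInstance, S.toLimit 0, inferInstance, S.toLimit_injective 0,
    S.isAlephNullExistentiallyClosed_limit⟩

/-- The passage to a finitely generated subgroup and the local form of soficity allow the
universe to be changed. -/
theorem exists_countable_not_isSofic (H : Type u) [Group H] (hH : ¬ IsSofic H) :
    ∃ (G : Type v) (_ : Group G), Countable G ∧ ¬ IsSofic G := by
  obtain ⟨F, hF⟩ : ∃ F : Finset H, ¬ HasSoficApproximations (Subgroup.closure (F : Set H)) := by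
    by_contra! h
    exact hH (HasSoficApproximations.of_closure h).isSofic
  have hc : Countable (Subgroup.closure (F : Set H)) := F.countable_toSet.subgroup_closure
  let e : Shrink.{v} (Subgroup.closure (F : Set H)) ≃* Subgroup.closure (F : Set H) :=
    Shrink.mulEquiv
  exact ⟨Shrink.{v} (Subgroup.closure (F : Set H)), inferInstance, e.injective.countable,
    fun h => hF (h.hasSoficApproximations.of_injective e.symm.toMonoidHom e.symm.injective)⟩

theorem exists_countable_isAlephNullExistentiallyClosed_not_isSofic (H : Type u) [Group H]
    (hH : ¬ IsSofic H) : ∃ (G : Type v) (_ : Group G),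
      Countable G ∧ IsAlephNullExistentiallyClosed G ∧ ¬ IsSofic G := by
  obtain ⟨G₀, _, _, hG₀⟩ := exists_countable_not_isSofic.{u, v} H hH
  obtain ⟨G, hG, φ, hc, hφ, hec⟩ := exists_countable_isAlephNullExistentiallyClosed G₀
  exact ⟨G, hG, hc, hec, fun h => hG₀ (h.of_injective φ hφ)⟩

/-! ### Conjugacy and centralizers in existentially closed groups -/

/-- Existential closedness, with finite families instead of finite sets of words and with an
arbitrary finite set of variables. -/
theorem IsAlephNullExistentiallyClosed.exists_solution {G : Type v} [Group G]
    (hG : IsAlephNullExistentiallyClosed G) {ι α β : Type*} [Finite ι] [Finite α] [Finite β]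
    (E : α → Monoid.Coprod G (FreeGroup ι)) (I : β → Monoid.Coprod G (FreeGroup ι))
    {K : Type v} [Group K] {φ : G →* K} (hφ : Function.Injective φ) (x : ι → K)
    (hE : ∀ a, Monoid.Coprod.lift φ (FreeGroup.lift x) (E a) = 1)
    (hI : ∀ b, Monoid.Coprod.lift φ (FreeGroup.lift x) (I b) ≠ 1) :
    ∃ y : ι → G, (∀ a, Monoid.Coprod.lift (MonoidHom.id G) (FreeGroup.lift y) (E a) = 1) ∧
      ∀ b, Monoid.Coprod.lift (MonoidHom.id G) (FreeGroup.lift y) (I b) ≠ 1 := by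
  classical
  obtain ⟨m, ⟨e⟩⟩ := Finite.exists_equiv_fin ι
  have := Fintype.ofFinite α
  have := Fintype.ofFinite β
  let r : Monoid.Coprod G (FreeGroup ι) →* WordOver G m :=
    Monoid.Coprod.map (MonoidHom.id G) (FreeGroup.map e)
  have hr : ∀ {L : Type v} [Group L] (ψ : G →* L) (z : Fin m → L) (w),
      WordOver.eval ψ z (r w) = Monoid.Coprod.lift ψ (FreeGroup.lift (z ∘ e)) w := by
    intro L _ ψ z w
    refine DFunLike.congr_fun (f := (WordOver.eval ψ z).comp r) ?_ w
    ext <;> simp [WordOver.eval, r]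
  obtain ⟨y, hyE, hyI⟩ := hG m (Finset.univ.image fun a => r (E a))
    (Finset.univ.image fun b => r (I b)) ⟨K, inferInstance, φ, hφ, x ∘ e.symm, by
      simpa [IsSolution, hr, Function.comp_assoc] using ⟨hE, hI⟩⟩
  exact ⟨y ∘ e, by simpa [IsSolution, hr] using hyE, by simpa [IsSolution, hr] using hyI⟩

/-- Any two embeddings of a finitely generated group in an `ℵ₀`-existentially closed group are
conjugate: a conjugating element exists in an HNN extension. -/
theorem IsAlephNullExistentiallyClosed.exists_conj {G : Type v} [Group G]
    (hG : IsAlephNullExistentiallyClosed G) {H : Type*} [Group H] [Group.FG H] {i j : H →* G}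
    (hi : Function.Injective i) (hj : Function.Injective j) :
    ∃ t : G, ∀ h, t * i h * t⁻¹ = j h := by
  obtain ⟨S, hS⟩ := Group.fg_def.1 ‹Group.FG H›
  let φ : i.range ≃* j.range := (MonoidHom.ofInjective hi).symm.trans (MonoidHom.ofInjective hj)
  have hφ : ∀ h, (φ ⟨i h, h, rfl⟩ : G) = j h := by
    intro h
    have : (MonoidHom.ofInjective hi).symm ⟨i h, h, rfl⟩ = h :=
      (MulEquiv.symm_apply_eq _).2 rfl
    simp only [φ, MulEquiv.trans_apply, this]
    rfl
  obtain ⟨y, hy, -⟩ := hG.exists_solution (ι := Unit) (α := S) (β := Empty)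
    (fun s => .inr (.of ()) * .inl (i s) * .inr (.of ())⁻¹ * .inl (j s)⁻¹) Empty.elim
    (HNNExtension.of_injective (G := G) (A := i.range) (B := j.range) φ)
    (fun _ => HNNExtension.t) (by
      intro s
      have := HNNExtension.equiv_eq_conj (φ := φ) ⟨i s, s, rfl⟩
      rw [hφ] at this
      simp only [map_mul, Monoid.Coprod.lift_apply_inr, Monoid.Coprod.lift_apply_inl,
        FreeGroup.lift_apply_of, map_inv]
      rw [← this, mul_inv_cancel]) (by simp)
  refine ⟨y (), fun h => ?_⟩
  have hext : ((MulAut.conj (y ())).toMonoidHom.comp i) = j := by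
    refine MonoidHom.eq_of_eqOn_dense hS fun s hs => ?_
    have := hy ⟨s, hs⟩
    simp only [map_mul, Monoid.Coprod.lift_apply_inr, Monoid.Coprod.lift_apply_inl,
        FreeGroup.lift_apply_of, map_inv, MonoidHom.id_apply] at this
    exact mul_inv_eq_one.1 this
  exact DFunLike.congr_fun hext h

/-- The double centralizer property, in the form that inclusions between centralizers of finitely
generated subgroups can be reversed. The element commuting with `A` but not with a given `b ∉ A` is
found in the symmetric group on the set `G`, where `G` acts by left multiplication: right
multiplication by a nontrivial `c ∈ A` on `A`, and the identity outside `A`. -/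
theorem IsAlephNullExistentiallyClosed.le_of_centralizer_le {G : Type v} [Group G]
    (hG : IsAlephNullExistentiallyClosed G) {A B : Subgroup G} (hA : A.FG) (hA' : A ≠ ⊥)
    (h : Subgroup.centralizer (A : Set G) ≤ Subgroup.centralizer (B : Set G)) : B ≤ A := by
  classical
  intro b hb
  by_contra hbA
  obtain ⟨c, hcA, hc⟩ := (Subgroup.bot_or_exists_ne_one A).resolve_left hA'
  obtain ⟨S, hS⟩ := hA
  have hmem : ∀ {g d : G}, d ∈ A → (g * d ∈ A ↔ g ∈ A) := fun hd => A.mul_mem_cancel_right hd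
  let t : Equiv.Perm G :=
    { toFun := fun g => if g ∈ A then g * c else g
      invFun := fun g => if g ∈ A then g * c⁻¹ else g
      left_inv := fun g => by
        by_cases hg : g ∈ A <;> simp [hg, hmem hcA]
      right_inv := fun g => by
        by_cases hg : g ∈ A <;> simp [hg, hmem (inv_mem hcA)] }
  have ht : ∀ g, t g = if g ∈ A then g * c else g := fun g => rfl
  obtain ⟨y, hyE, hyI⟩ := hG.exists_solution (ι := Unit) (α := S) (β := Unit)
    (fun s => .inr (.of ()) * .inl s * .inr (.of ())⁻¹ * .inl (s : G)⁻¹)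
    (fun _ => .inr (.of ()) * .inl b * .inr (.of ())⁻¹ * .inl b⁻¹)
    (φ := MulAction.toPermHom G G) MulAction.toPerm_injective
    (fun _ => t) (by
      intro s
      have hs : (s : G) ∈ A := hS ▸ Subgroup.subset_closure s.2
      simp only [map_mul, Monoid.Coprod.lift_apply_inr, Monoid.Coprod.lift_apply_inl,
        FreeGroup.lift_apply_of, map_inv]
      rw [mul_inv_eq_one, mul_inv_eq_iff_eq_mul]
      ext g
      by_cases hg : g ∈ A <;>
        simp [ht, hg, A.mul_mem_cancel_left hs, mul_assoc]) (by
      intro _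
      simp only [map_mul, Monoid.Coprod.lift_apply_inr, Monoid.Coprod.lift_apply_inl,
        FreeGroup.lift_apply_of, map_inv]
      rw [Ne, mul_inv_eq_one, mul_inv_eq_iff_eq_mul]
      intro h
      have := DFunLike.congr_fun h (1 : G)
      simp [ht, hbA, A.one_mem, hc] at this)
  simp only [map_mul, Monoid.Coprod.lift_apply_inr, Monoid.Coprod.lift_apply_inl,
    FreeGroup.lift_apply_of, map_inv, MonoidHom.id_apply, Ne, mul_inv_eq_iff_eq_mul, one_mul]
    at hyE hyI
  have hy : y () ∈ Subgroup.centralizer (A : Set G) := by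
    rw [← hS, Subgroup.centralizer_closure, Subgroup.mem_centralizer_iff]
    exact fun s hs => (hyE ⟨s, hs⟩).symm
  exact hyI () (Subgroup.mem_centralizer_iff.1 (h hy) b hb).symm

theorem IsAlephNullExistentiallyClosed.centralizer_le_iff {G : Type v} [Group G]
    (hG : IsAlephNullExistentiallyClosed G) {A B : Subgroup G} (hA : A.FG) (hA' : A ≠ ⊥) :
    Subgroup.centralizer (A : Set G) ≤ Subgroup.centralizer (B : Set G) ↔ B ≤ A :=
  ⟨hG.le_of_centralizer_le hA hA', fun h => Subgroup.centralizer_le h⟩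

/-! ### Free subgroups forced by ping-pong -/

/-- A ping-pong criterion stated through subgroups: `P none` is moved by each letter `l` into
`P (some l)`, which in turn absorbs all the images of the subgroups except that of the inverse
letter. -/
theorem FreeGroup.lift_injective_of_subgroup_ping_pong {G κ : Type*} [Group G] (a : κ → G)
    (P : Option (κ × Bool) → Subgroup G)
    (hcomm : ∀ l, ∀ x ∈ P none, ∀ y ∈ P (some l), x * y = y * x)
    (hP : ∃ x ∈ P none, ∃ y ∈ P none, x * y ≠ y * x)
    (hmap : ∀ (l : κ × Bool) (i : Option (κ × Bool)), i ≠ some (l.1, !l.2) → ∀ x ∈ P i,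
      FreeGroup.lift a (FreeGroup.mk [l]) * x * (FreeGroup.lift a (FreeGroup.mk [l]))⁻¹ ∈
        P (some l)) :
    Function.Injective (FreeGroup.lift a) := by
  classical
  have key : ∀ (l : κ × Bool) (L : List (κ × Bool)), FreeGroup.IsReduced (l :: L) →
      ∀ x ∈ P none, FreeGroup.lift a (FreeGroup.mk (l :: L)) * x *
        (FreeGroup.lift a (FreeGroup.mk (l :: L)))⁻¹ ∈ P (some l) := by
    intro l L
    induction L generalizing l with
    | nil => exact fun _ x hx => hmap l none (by simp) x hx
    | cons l' L ih =>
      intro hred x hx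
      rw [FreeGroup.isReduced_cons_cons] at hred
      have hsplit : FreeGroup.mk (l :: l' :: L) = FreeGroup.mk [l] * FreeGroup.mk (l' :: L) := rfl
      rw [hsplit, _root_.map_mul]
      have := hmap l (some l') (by
        rintro h
        obtain rfl := Option.some_injective _ h
        simpa using hred.1 rfl) _ (ih l' hred.2 x hx)
      simpa only [mul_inv_rev, mul_assoc] using this
  refine (injective_iff_map_eq_one _).2 fun w hw => ?_
  by_contra hw1
  obtain ⟨l, L, hL⟩ := List.exists_cons_of_ne_nil (mt FreeGroup.toWord_eq_nil_iff.1 hw1)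
  obtain ⟨x, hx, y, hy, hxy⟩ := hP
  have h := key l L (hL ▸ FreeGroup.isReduced_toWord) y hy
  rw [← hL, FreeGroup.mk_toWord, hw, one_mul, inv_one, mul_one] at h
  exact hxy (hcomm l x hx y h)

section Perm

variable {X : Type v}

theorem Equiv.Perm.exists_extend [Countable X] {Y : Type*} (f g : Y ↪ X)
    (hf : (Set.range f)ᶜ.Infinite) (hg : (Set.range g)ᶜ.Infinite) :
    ∃ κ : Equiv.Perm X, ∀ y, κ (f y) = g y := by
  classical
  have := hf.to_subtype
  have := hg.to_subtype
  obtain ⟨e⟩ : Nonempty (↥(Set.range f)ᶜ ≃ ↥(Set.range g)ᶜ) := nonempty_equiv_of_countable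
  let κ : Equiv.Perm X := (Equiv.Set.sumCompl (Set.range f)).symm.trans
    (((((Equiv.ofInjective f f.injective).symm.trans (Equiv.ofInjective g g.injective)).sumCongr
      e)).trans (Equiv.Set.sumCompl (Set.range g)))
  refine ⟨κ, fun y => ?_⟩
  have h : (Equiv.Set.sumCompl (Set.range f)).symm (f y) = Sum.inl ⟨f y, y, rfl⟩ :=
    Equiv.Set.sumCompl_symm_apply_of_mem (Set.mem_range_self y)
  have h' : (Equiv.ofInjective f f.injective).symm ⟨f y, y, rfl⟩ = y :=
    Equiv.ofInjective_symm_apply f.injective y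
  simp only [κ, Equiv.trans_apply, h, Equiv.sumCongr_apply, Sum.map_inl, h']
  simp

theorem Equiv.Perm.viaEmbedding_trans {Y Z : Type*} (e : Equiv.Perm X) (f : X ↪ Y) (g : Y ↪ Z) :
    (e.viaEmbedding f).viaEmbedding g = e.viaEmbedding (f.trans g) := by
  ext z
  by_cases hz : z ∈ Set.range g
  · obtain ⟨y, rfl⟩ := hz
    rw [Equiv.Perm.viaEmbedding_apply]
    by_cases hy : y ∈ Set.range f
    · obtain ⟨x, rfl⟩ := hy
      rw [Equiv.Perm.viaEmbedding_apply]
      exact (Equiv.Perm.viaEmbedding_apply e (f.trans g) x).symm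
    · rw [Equiv.Perm.viaEmbedding_apply_of_notMem _ _ _ hy,
        Equiv.Perm.viaEmbedding_apply_of_notMem]
      rintro ⟨x, hx⟩
      exact hy ⟨x, g.injective hx⟩
  · rw [Equiv.Perm.viaEmbedding_apply_of_notMem _ _ _ hz,
      Equiv.Perm.viaEmbedding_apply_of_notMem]
    rintro ⟨x, hx⟩
    exact hz ⟨f x, hx⟩

theorem Equiv.Perm.mul_viaEmbedding_mul_inv {Y : Type*} {κ : Equiv.Perm Y} {f g : X ↪ Y}
    (h : ∀ x, κ (f x) = g x) (e : Equiv.Perm X) :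
    κ * e.viaEmbedding f * κ⁻¹ = e.viaEmbedding g := by
  rw [mul_inv_eq_iff_eq_mul]
  ext y
  simp only [Equiv.Perm.mul_apply]
  by_cases hy : y ∈ Set.range f
  · obtain ⟨x, rfl⟩ := hy
    rw [Equiv.Perm.viaEmbedding_apply, h, h, Equiv.Perm.viaEmbedding_apply]
  · rw [Equiv.Perm.viaEmbedding_apply_of_notMem _ _ _ hy,
      Equiv.Perm.viaEmbedding_apply_of_notMem]
    rintro ⟨x, hx⟩
    exact hy ⟨x, κ.injective ((h x).trans hx)⟩

theorem Equiv.Perm.viaEmbedding_commute {Y : Type*} {f g : X ↪ Y} (h : ∀ x y, f x ≠ g y)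
    (d e : Equiv.Perm X) : d.viaEmbedding f * e.viaEmbedding g =
      e.viaEmbedding g * d.viaEmbedding f := by
  ext y
  simp only [Equiv.Perm.mul_apply]
  by_cases hf : y ∈ Set.range f
  · obtain ⟨x, rfl⟩ := hf
    have hn : ∀ x, f x ∉ Set.range g := fun x ⟨z, hz⟩ => h x z hz.symm
    rw [Equiv.Perm.viaEmbedding_apply_of_notMem _ _ _ (hn x), Equiv.Perm.viaEmbedding_apply,
      Equiv.Perm.viaEmbedding_apply_of_notMem _ _ _ (hn _)]
  · rw [Equiv.Perm.viaEmbedding_apply_of_notMem d f _ hf]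
    by_cases hg : y ∈ Set.range g
    · obtain ⟨x, rfl⟩ := hg
      have hn : ∀ x, g x ∉ Set.range f := fun x ⟨z, hz⟩ => h z x hz
      rw [Equiv.Perm.viaEmbedding_apply, Equiv.Perm.viaEmbedding_apply_of_notMem _ _ _ (hn _)]
    · rw [Equiv.Perm.viaEmbedding_apply_of_notMem e g _ hg,
        Equiv.Perm.viaEmbedding_apply_of_notMem d f _ hf]

end Perm

/-- Ping-pong in a symmetric group with letters from `κ`, described by finitely many equations and
inequations between permutations. The permutations `k i s`, `s : σ`, generate a copy, supported on
one of finitely many disjoint copies of `X` inside `X`, of a finitely generated group that contains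
its own copies: `W i s` is a word for the copy with index `i` of the generator `s`. The letter `l`
carries the copies, except that of the inverse letter, into the copy of index `some l`. -/
theorem exists_perm_ping_pong (κ : Type) [Finite κ] [Nonempty κ] (X : Type v) [Countable X]
    [Infinite X] :
    ∃ (σ : Type) (_ : Finite σ) (W : Option (κ × Bool) → σ → FreeGroup σ) (s₀ s₁ : σ)
      (k : Option (κ × Bool) → σ → Equiv.Perm X) (a : κ × Bool → Equiv.Perm X),
      (∀ i j, i ≠ j → ∀ s t, k i s * k j t = k j t * k i s) ∧
      (∀ i, k i s₀ * k i s₁ ≠ k i s₁ * k i s₀) ∧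
      (∀ j, a (j, false) = (a (j, true))⁻¹) ∧
      ∀ (l : κ × Bool) (i : Option (κ × Bool)), i ≠ some (l.1, !l.2) → ∀ s,
        a l * k i s * (a l)⁻¹ = FreeGroup.lift (k (some l)) (W i s) := by
  classical
  let ι := Option (κ × Bool)
  obtain ⟨e'⟩ : Nonempty (ι × X ≃ X) := nonempty_equiv_of_countable
  let e : ι → X ↪ X := fun i => ⟨fun x => e' (i, x), fun x y h => by simpa using h⟩
  have he : ∀ i j, i ≠ j → ∀ x y, e i x ≠ e j y := fun i j hij x y h => by
    have := congrArg Prod.fst (e'.injective h)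
    exact hij this
  have hinf : ∀ i (S : Set X), (∀ x ∈ S, ∀ y, x ≠ e i y) → Sᶜ.Infinite := fun i S hS =>
    (Set.infinite_range_of_injective (e i).injective).mono (by
      rintro _ ⟨y, rfl⟩ hy
      exact hS _ hy y rfl)
  have hother : ∀ i : ι, ∃ j, j ≠ i := fun i => exists_ne i
  -- `c i j` carries the iterated copies along `e j` and `e i` to copies along `e i`
  have hc : ∀ i j : ι, ∃ c : Equiv.Perm X, ∀ x, c ((e j).trans (e i) x) = e i x := by
    intro i j
    obtain ⟨i', hi'⟩ := hother i
    refine Equiv.Perm.exists_extend _ _ (hinf i' _ ?_) (hinf i' _ ?_) <;> rintro _ ⟨x, rfl⟩ y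
    · exact he i i' hi'.symm _ _
    · exact he i i' hi'.symm _ _
  choose c hc using hc
  obtain ⟨p, q, hpq⟩ : ∃ p q : Equiv.Perm X, p * q ≠ q * p := by
    obtain ⟨f⟩ : Nonempty (ℕ ↪ X) := ⟨Infinite.natEmbedding X⟩
    refine ⟨Equiv.swap (f 0) (f 1), Equiv.swap (f 1) (f 2), fun h => ?_⟩
    have := DFunLike.congr_fun h (f 0)
    have h01 : f 0 ≠ f 1 := f.injective.ne (by decide)
    have h02 : f 0 ≠ f 2 := f.injective.ne (by decide)
    have h12 : f 1 ≠ f 2 := f.injective.ne (by decide)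
    simp [Equiv.swap_apply_of_ne_of_ne h01 h02, h12] at this
  let σ₀ := (ι × ι) ⊕ Bool
  let g₀ : σ₀ → Equiv.Perm X := Sum.elim (fun ij => c ij.1 ij.2) (fun b => if b then p else q)
  let σ := σ₀ ⊕ (ι × σ₀)
  let g : σ → Equiv.Perm X := Sum.elim g₀ (fun is => (g₀ is.2).viaEmbedding (e is.1))
  have hg : ∀ s, g s ∈ (FreeGroup.lift g).range := fun s => ⟨FreeGroup.of s, by simp⟩
  have hW : ∀ i s, ∃ w : FreeGroup σ, FreeGroup.lift g w = (g s).viaEmbedding (e i) := by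
    rintro i (s | ⟨j, s⟩)
    · exact hg (Sum.inr (i, s))
    · change (g (Sum.inr (j, s))).viaEmbedding (e i) ∈ (FreeGroup.lift g).range
      have h1 : (g (Sum.inr (j, s))).viaEmbedding (e i) =
          (c i j)⁻¹ * (g₀ s).viaEmbedding (e i) * c i j := by
        simp only [g, Sum.elim_inr, Equiv.Perm.viaEmbedding_trans]
        rw [← Equiv.Perm.mul_viaEmbedding_mul_inv (hc i j) (g₀ s)]
        group
      rw [h1]
      exact mul_mem (mul_mem (inv_mem (hg (Sum.inl (Sum.inl (i, j))))) (hg (Sum.inr (i, s))))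
        (hg (Sum.inl (Sum.inl (i, j))))
  choose W hW using hW
  -- the two conditions prescribe an injection on the complement of the infinite set
  -- `Set.range (e (some (j, false)) ∘ e (some (j, true)))`
  have ha : ∀ j : κ, ∃ a : Equiv.Perm X,
      (∀ i, i ≠ some (j, false) → ∀ x, a (e i x) = e (some (j, true)) (e i x)) ∧
      (∀ i, i ≠ some (j, true) → ∀ x, a⁻¹ (e i x) = e (some (j, false)) (e i x)) := by
    intro j
    let F : ∀ u v : ι, u ≠ v → ({i // i ≠ u} × X) ⊕ ({i // i ≠ v} × X) ↪ X := fun u v huv =>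
      ⟨Sum.elim (fun y => e y.1 y.2) (fun y => e u (e y.1 y.2)), by
        have hinj : ∀ (w : ι) (y y' : {i // i ≠ w} × X), e y.1 y.2 = e y'.1 y'.2 → y = y' := by
          rintro w ⟨⟨i, hi⟩, x⟩ ⟨⟨i', hi'⟩, x'⟩ h
          have := e'.injective h
          simp only [Prod.mk.injEq] at this
          obtain ⟨rfl, rfl⟩ := this
          rfl
        rintro (y | y) (y' | y') h
        · exact congrArg _ (hinj u _ _ h)
        · exact absurd h (he _ _ y.1.2 _ _)
        · exact absurd h (he _ _ y'.1.2.symm _ _)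
        · exact congrArg _ (hinj v _ _ ((e u).injective h))⟩
    have hF : ∀ u v huv, (Set.range (F u v huv))ᶜ.Infinite := by
      intro u v huv
      refine (Set.infinite_range_of_injective ((e v).trans (e u)).injective).mono ?_
      rintro _ ⟨x, rfl⟩ ⟨y | y, hy⟩
      · exact he _ _ y.1.2 _ _ hy
      · exact he _ _ y.1.2 _ _ ((e u).injective hy)
    have huv : some (j, false) ≠ some (j, true) := by simp
    obtain ⟨a, ha⟩ := Equiv.Perm.exists_extend (F _ _ huv)
      ((Equiv.sumComm _ _).toEmbedding.trans (F _ _ huv.symm)) (hF _ _ huv)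
      (by rw [Function.Embedding.coe_trans, Equiv.coe_toEmbedding,
            (Equiv.surjective _).range_comp]; exact hF _ _ huv.symm)
    refine ⟨a, fun i hi x => ha (Sum.inl (⟨i, hi⟩, x)), fun i hi x => ?_⟩
    rw [Equiv.Perm.inv_eq_iff_eq]
    exact (ha (Sum.inr (⟨i, hi⟩, x))).symm
  choose a ha ha' using ha
  have hlift : ∀ i w, FreeGroup.lift (fun s => (g s).viaEmbedding (e i)) w =
      (FreeGroup.lift g w).viaEmbedding (e i) := by
    intro i w
    refine DFunLike.congr_fun (f := FreeGroup.lift (fun s => (g s).viaEmbedding (e i)))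
      (g := (Equiv.Perm.viaEmbeddingHom (e i)).comp (FreeGroup.lift g)) ?_ w
    ext1 s
    simp [Equiv.Perm.viaEmbeddingHom_apply]
  refine ⟨σ, inferInstance, W, Sum.inl (Sum.inr true), Sum.inl (Sum.inr false),
    fun i s => (g s).viaEmbedding (e i), fun l => if l.2 then a l.1 else (a l.1)⁻¹,
    fun i j hij s t => Equiv.Perm.viaEmbedding_commute (he i j hij) _ _, fun i h => ?_,
    fun j => by simp, ?_⟩
  · simp only [← Equiv.Perm.viaEmbeddingHom_apply, ← map_mul] at h
    exact hpq (by simpa [g, g₀] using Equiv.Perm.viaEmbeddingHom_injective (e i) h)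
  · intro l i hi s
    rw [hlift, hW, Equiv.Perm.viaEmbedding_trans]
    refine Equiv.Perm.mul_viaEmbedding_mul_inv (fun x => ?_) _
    obtain ⟨j, _ | _⟩ := l
    · simpa using ha' j i hi x
    · simpa using ha j i hi x

/-- Every finite subset of an `ℵ₀`-existentially closed group commutes with a free subgroup of any
given positive finite rank: freeness is forced by a finite system describing a game of ping-pong,
which has a solution in the product with an infinite symmetric group. -/
theorem IsAlephNullExistentiallyClosed.exists_freeGroup_commute {G : Type v} [Group G]
    (hG : IsAlephNullExistentiallyClosed G) (κ : Type) [Finite κ] [Nonempty κ] {B : Subgroup G}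
    (hB : B.FG) : ∃ ψ : FreeGroup κ →* G, Function.Injective ψ ∧
      ∀ b ∈ B, ∀ w, b * ψ w = ψ w * b := by
  classical
  obtain ⟨S, hS⟩ := hB
  obtain ⟨σ, hσ, W, s₀, s₁, k, a, hk, hne, ha, hmap⟩ :=
    exists_perm_ping_pong κ (ULift.{v} ℕ)
  let ι := Option (κ × Bool)
  let V := (ι × σ) ⊕ (κ × Bool)
  let kv : ι → σ → Monoid.Coprod G (FreeGroup V) := fun i s => .inr (.of (Sum.inl (i, s)))
  let av : κ × Bool → Monoid.Coprod G (FreeGroup V) := fun l => .inr (.of (Sum.inr l))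
  have hkv : ∀ {L : Type v} [Group L] (φ : G →* L) (y : V → L) (i s),
      Monoid.Coprod.lift φ (FreeGroup.lift y) (kv i s) = y (Sum.inl (i, s)) := by simp [kv]
  have hav : ∀ {L : Type v} [Group L] (φ : G →* L) (y : V → L) (l),
      Monoid.Coprod.lift φ (FreeGroup.lift y) (av l) = y (Sum.inr l) := by simp [av]
  have hlift : ∀ {L : Type v} [Group L] (φ : G →* L) (y : V → L) (i w),
      Monoid.Coprod.lift φ (FreeGroup.lift y) (FreeGroup.lift (kv i) w) =
        FreeGroup.lift (fun s => y (Sum.inl (i, s))) w := by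
    intro L _ φ y i w
    refine DFunLike.congr_fun (f := (Monoid.Coprod.lift φ (FreeGroup.lift y)).comp
      (FreeGroup.lift (kv i))) ?_ w
    ext1 s
    simp [hkv]
  obtain ⟨y, hyE, hyI⟩ := hG.exists_solution (ι := V)
    (α := (({p : ι × ι // p.1 ≠ p.2} × σ × σ) ⊕ κ) ⊕
      (({p : (κ × Bool) × ι // p.2 ≠ some (p.1.1, !p.1.2)} × σ) ⊕ (S × κ × Bool))) (β := Unit)
    (Sum.elim
      (Sum.elim (fun p => kv p.1.1.1 p.2.1 * kv p.1.1.2 p.2.2 *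
          (kv p.1.1.2 p.2.2 * kv p.1.1.1 p.2.1)⁻¹)
        (fun j => av (j, false) * av (j, true)))
      (Sum.elim (fun p => av p.1.1.1 * kv p.1.1.2 p.2 * (av p.1.1.1)⁻¹ *
          (FreeGroup.lift (kv (some p.1.1.1)) (W p.1.1.2 p.2))⁻¹)
        (fun p => .inl p.1 * av p.2 * (av p.2 * .inl p.1)⁻¹)))
    (fun _ => kv none s₀ * kv none s₁ * (kv none s₁ * kv none s₀)⁻¹)
    (φ := MonoidHom.inl G (Equiv.Perm (ULift.{v} ℕ))) (fun g h hgh => congrArg Prod.fst hgh)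
    (Sum.elim (fun p => (1, k p.1 p.2)) (fun l => (1, a l))) (by
      have hinr : ∀ i w, FreeGroup.lift (fun s => ((1 : G), k i s)) w =
          (1, FreeGroup.lift (k i) w) := fun i w =>
        DFunLike.congr_fun (f := FreeGroup.lift fun s => ((1 : G), k i s))
          (g := (MonoidHom.inr G _).comp (FreeGroup.lift (k i))) (by ext1 s; simp) w
      rintro ((⟨⟨⟨i, j⟩, hij⟩, s, t⟩ | j) | (⟨⟨⟨l, i⟩, hi⟩, s⟩ | ⟨b, l⟩))
      · simp only [Sum.elim_inl, map_mul, map_inv, hkv, mul_inv_eq_one, Prod.mk_mul_mk,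
          hk i j hij s t]
      · simp [hav, ha]
      · simp only [Sum.elim_inl, Sum.elim_inr, map_mul, map_inv, hkv, hav, hlift, hinr,
          Prod.mk_mul_mk, Prod.inv_mk, hmap l i hi s]
        simp
      · simp [hav]) (by
      intro _
      simp only [Sum.elim_inl, map_mul, map_inv, hkv, Ne, mul_inv_eq_one, Prod.mk_mul_mk]
      exact fun h => hne none (congrArg Prod.snd h))
  let P : ι → Subgroup G := fun i => Subgroup.closure (Set.range fun s => y (Sum.inl (i, s)))
  have hmem : ∀ i s, y (Sum.inl (i, s)) ∈ P i := fun i s =>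
    Subgroup.subset_closure (Set.mem_range_self s)
  have hinv : ∀ l : κ × Bool, FreeGroup.lift (fun j => y (Sum.inr (j, true))) (FreeGroup.mk [l]) =
      y (Sum.inr l) := by
    rintro ⟨j, _ | _⟩
    · have := hyE (Sum.inl (Sum.inr j))
      simp only [Sum.elim_inl, Sum.elim_inr, map_mul, hav] at this
      simpa using (eq_inv_of_mul_eq_one_left this).symm
    · simp
  refine ⟨FreeGroup.lift fun j => y (Sum.inr (j, true)),
    FreeGroup.lift_injective_of_subgroup_ping_pong _ P (fun l => ?_)
      ⟨_, hmem none s₀, _, hmem none s₁, ?_⟩ (fun l i hi => ?_), ?_⟩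
  · suffices h : P (some l) ≤ Subgroup.centralizer (P none : Set G) from
      fun x hx y hy => Subgroup.mem_centralizer_iff.1 (h hy) x hx
    rw [Subgroup.closure_le, Subgroup.centralizer_closure]
    rintro _ ⟨t, rfl⟩
    rw [SetLike.mem_coe, Subgroup.mem_centralizer_iff]
    rintro _ ⟨s, rfl⟩
    have := hyE (Sum.inl (Sum.inl ⟨⟨(none, some l), by simp⟩, s, t⟩))
    simpa only [Sum.elim_inl, map_mul, map_inv, hkv, mul_inv_eq_one] using this
  · have := hyI ()
    simpa only [Ne, map_mul, map_inv, hkv, mul_inv_eq_one] using this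
  · suffices h : P i ≤ (P (some l)).comap (MulAut.conj (y (Sum.inr l))).toMonoidHom by
      intro x hx
      rw [hinv]
      exact h hx
    rw [Subgroup.closure_le]
    rintro _ ⟨s, rfl⟩
    have := hyE (Sum.inr (Sum.inl ⟨⟨(l, i), hi⟩, s⟩))
    simp only [Sum.elim_inl, Sum.elim_inr, map_mul, map_inv, hkv, hav, hlift,
      mul_inv_eq_one] at this
    change y (Sum.inr l) * y (Sum.inl (i, s)) * (y (Sum.inr l))⁻¹ ∈ P (some l)
    rw [this]
    refine (?_ : (FreeGroup.lift fun s => y (Sum.inl (some l, s))).range ≤ _) ⟨_, rfl⟩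
    rw [FreeGroup.range_lift_eq_closure]
  · suffices h : B ≤ Subgroup.centralizer
        (Set.range fun j => y (Sum.inr (j, true))) by
      intro b hb w
      have hb' := h hb
      rw [← Subgroup.centralizer_closure, ← FreeGroup.range_lift_eq_closure] at hb'
      exact (Subgroup.mem_centralizer_iff.1 hb' _ ⟨w, rfl⟩).symm
    rw [← hS, Subgroup.closure_le]
    intro b hb
    rw [SetLike.mem_coe, Subgroup.mem_centralizer_iff]
    rintro _ ⟨j, rfl⟩
    have := hyE (Sum.inr (Sum.inr (⟨b, hb⟩, j, true)))
    simp only [Sum.elim_inr, map_mul, map_inv, hav, Monoid.Coprod.lift_apply_inl,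
      MonoidHom.id_apply, mul_inv_eq_one] at this
    exact this.symm

/-! ### A dense chain of subgroups of a free group -/

/-- A dense strict order with at least one related pair contains a chain of the order type of `ℚ`:
a maximal chain is densely ordered. -/
theorem exists_rat_chain {α : Type*} {r : α → α → Prop} [IsStrictOrder α r]
    (hdense : ∀ a b, r a b → ∃ c, r a c ∧ r c b) {a b : α} (hab : r a b) :
    ∃ f : ℚ → α, ∀ p q, p < q → r (f p) (f q) := by
  classical
  let _ : PartialOrder α := partialOrderOfSO r
  have hlt : a < b := hab
  obtain ⟨s, hs⟩ := (IsChain.pair (r := (· ≤ ·)) hlt.le).exists_subset_flag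
  have : DenselyOrdered s := by
    refine ⟨fun x y hxy => ?_⟩
    by_contra! hgap
    obtain ⟨c, hxc, hcy⟩ := hdense x.1 y.1 hxy
    have hxc : x.1 < c := hxc
    have hcy : c < y.1 := hcy
    have hc : c ∈ s := by
      rw [Flag.mem_iff_forall_le_or_ge]
      intro d hd
      rcases le_or_gt (⟨d, hd⟩ : s) x with h | h
      · exact Or.inr ((show d ≤ x.1 from h).trans hxc.le)
      · exact Or.inl (hcy.le.trans (show y.1 ≤ d from hgap _ h))
    exact not_le.2 (show (⟨c, hc⟩ : s) < y from hcy) (hgap ⟨c, hc⟩ hxc)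
  have : Nontrivial s := ⟨⟨a, hs (by simp)⟩, ⟨b, hs (by simp)⟩,
    fun h => hlt.ne (congrArg Subtype.val h)⟩
  obtain ⟨f⟩ := Order.embedding_from_countable_to_dense (α := ℚ) (β := s)
  exact ⟨fun q => f q, fun p q hpq => f.lt_iff_lt.2 hpq⟩

/-- `B.IsFreelyBelow A` says that `A` contains a free product of `B` with an infinite cyclic group
generated by some `z`. The free product is described by its universal property: homomorphisms on
`B` extend to a subgroup `E` containing `B` and `z`, with an arbitrary image of `z`. -/
def Subgroup.IsFreelyBelow {F : Type} [Group F] (B A : Subgroup F) : Prop :=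
  B ≤ A ∧ ∃ E ≤ A, B ≤ E ∧ ∃ (z : F) (hz : z ∈ E), ∀ (Q : Type) [Group Q] (f : B →* Q) (q : Q),
    ∃ h : E →* Q, (∀ b (hb : b ∈ B) (hb' : b ∈ E), h ⟨b, hb'⟩ = f ⟨b, hb⟩) ∧ h ⟨z, hz⟩ = q

namespace Subgroup.IsFreelyBelow

variable {F : Type} [Group F] {A B C : Subgroup F}

theorem lt (h : B.IsFreelyBelow A) : B < A := by
  obtain ⟨hBA, E, hEA, hBE, z, hz, hE⟩ := h
  refine lt_of_le_of_ne hBA fun heq => ?_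
  have hzB : z ∈ B := heq ▸ hEA hz
  obtain ⟨h, h1, h2⟩ := hE (Multiplicative ℤ) 1 (Multiplicative.ofAdd 1)
  rw [h1 z hzB hz, MonoidHom.one_apply] at h2
  exact absurd h2 (by decide)

theorem trans (hCB : C.IsFreelyBelow B) (hBA : B.IsFreelyBelow A) : C.IsFreelyBelow A := by
  obtain ⟨hle, E, hEB, h⟩ := hCB
  exact ⟨hle.trans hBA.1, E, hEB.trans hBA.1, h⟩

/-- If `E` is, in the sense of the universal property, a free product of `B` and `⟨z⟩`, then the
conjugates of `B` by `1`, `z` and `z ^ 2` generate their free product. A homomorphism prescribed on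
the three conjugates is found as a coordinate of a homomorphism from `E` to a wreath product with
`ℤ` that maps `z` to the shift. -/
theorem exists_hom_of_conj {E : Subgroup F} (hBE : B ≤ E) {z : F} (hz : z ∈ E)
    (hE : ∀ (Q : Type) [Group Q] (f : B →* Q) (q : Q), ∃ h : E →* Q,
      (∀ b (hb : b ∈ B) (hb' : b ∈ E), h ⟨b, hb'⟩ = f ⟨b, hb⟩) ∧ h ⟨z, hz⟩ = q)
    {y : F} (hy : y ∈ B) {Q : Type} [Group Q] (f₀ f₁ f₂ : B →* Q) {D : Subgroup F}
    (hD : D = B ⊔ Subgroup.closure {z * y * z⁻¹, z * (z * y * z⁻¹) * z⁻¹}) :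
    D ≤ E ∧ ∃ h : D →* Q, (∀ b (hb : b ∈ B) (hb' : b ∈ D), h ⟨b, hb'⟩ = f₀ ⟨b, hb⟩) ∧
      (∀ hb', h ⟨z * y * z⁻¹, hb'⟩ = f₁ ⟨y, hy⟩) ∧
      ∀ hb', h ⟨z * (z * y * z⁻¹) * z⁻¹, hb'⟩ = f₂ ⟨y, hy⟩ := by
  let ψ : B →* RegularWreathProduct Q (Multiplicative ℤ) :=
    { toFun := fun b => ⟨fun n => if n = 1 then f₀ b else
        if n = Multiplicative.ofAdd 1 then f₁ b else f₂ b, 1⟩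
      map_one' := by ext <;> simp
      map_mul' := fun b b' => by
        ext n
        · simp only [RegularWreathProduct.mul_left, Pi.mul_apply, inv_one, one_mul, map_mul]
          split_ifs <;> rfl
        · simp }
  -- with this image of `z`, the coordinate at `1` of a conjugate by `z ^ k` is the coordinate at `k`
  obtain ⟨H, hHB, hHz⟩ := hE _ ψ (RegularWreathProduct.inl (Multiplicative.ofAdd (-1 : ℤ)))
  have hDE : D ≤ E := by
    rw [hD, sup_le_iff, Subgroup.closure_le]
    have h1 : z * y * z⁻¹ ∈ E := mul_mem (mul_mem hz (hBE hy)) (inv_mem hz)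
    refine ⟨hBE, ?_⟩
    rintro _ (rfl | rfl)
    exacts [h1, mul_mem (mul_mem hz h1) (inv_mem hz)]
  have h1E := hDE (hD ▸ Subgroup.mem_sup_right (Subgroup.subset_closure (by simp)) :
    z * y * z⁻¹ ∈ D)
  have h2E := hDE (hD ▸ Subgroup.mem_sup_right (Subgroup.subset_closure (by simp)) :
    z * (z * y * z⁻¹) * z⁻¹ ∈ D)
  have hH1 : H ⟨z * y * z⁻¹, h1E⟩ = RegularWreathProduct.inl (Multiplicative.ofAdd (-1 : ℤ)) *
      ψ ⟨y, hy⟩ * (RegularWreathProduct.inl (Multiplicative.ofAdd (-1 : ℤ)))⁻¹ := by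
    rw [← hHz, ← hHB y hy (hBE hy), ← map_mul, ← map_inv, ← map_mul]
    rfl
  have hH2 : H ⟨z * (z * y * z⁻¹) * z⁻¹, h2E⟩ =
      RegularWreathProduct.inl (Multiplicative.ofAdd (-1 : ℤ)) *
      H ⟨z * y * z⁻¹, h1E⟩ * (RegularWreathProduct.inl (Multiplicative.ofAdd (-1 : ℤ)))⁻¹ := by
    rw [← hHz, ← map_mul, ← map_inv, ← map_mul]
    rfl
  have hright : ∀ d (hd : d ∈ D), (H ⟨d, hDE hd⟩).right = 1 := by
    have hle : D ≤ ((RegularWreathProduct.rightHom.comp H).ker).map E.subtype := by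
      rw [hD, sup_le_iff, Subgroup.closure_le]
      refine ⟨fun b hb => ⟨⟨b, hBE hb⟩, ?_, rfl⟩, ?_⟩
      · rw [SetLike.mem_coe, MonoidHom.mem_ker, MonoidHom.comp_apply, hHB b hb]
        rfl
      · rintro _ (rfl | rfl)
        · refine ⟨⟨_, h1E⟩, ?_, rfl⟩
          rw [SetLike.mem_coe, MonoidHom.mem_ker, MonoidHom.comp_apply, hH1]
          simp [ψ]
        · refine ⟨⟨_, h2E⟩, ?_, rfl⟩
          rw [SetLike.mem_coe, MonoidHom.mem_ker, MonoidHom.comp_apply, hH2, hH1]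
          simp [ψ]
    intro d hd
    obtain ⟨⟨d', hd'⟩, hker, rfl⟩ := hle hd
    exact hker
  refine ⟨hDE, MonoidHom.mk' (fun d => (H ⟨d, hDE d.2⟩).left 1) (fun d d' => ?_), ?_, ?_, ?_⟩
  · have : H ⟨(d * d' : D), hDE (d * d').2⟩ = H ⟨d, hDE d.2⟩ * H ⟨d', hDE d'.2⟩ :=
      map_mul H ⟨d, hDE d.2⟩ ⟨d', hDE d'.2⟩
    rw [this, RegularWreathProduct.mul_left, hright d d.2]
    simp
  · intro b hb hb'
    simp [hHB b hb, ψ]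
  · intro hb'
    simp only [MonoidHom.mk'_apply, hH1]
    simp [ψ, RegularWreathProduct.mul_left]
  · intro hb'
    simp only [MonoidHom.mk'_apply, hH2, hH1]
    simp [ψ, RegularWreathProduct.mul_left]
    exact fun h => absurd h (by decide)

/-- Density: between `B` and `A` there is the subgroup generated by `B` and `z * y * z⁻¹`. The
element `y` has to be primitive in `B`, which is ensured by an exponent homomorphism `e`. -/
theorem exists_between (hBA : B.IsFreelyBelow A) {y : F} (hy : y ∈ B) {e : F →* Multiplicative ℤ}
    (he : e y = Multiplicative.ofAdd 1) (hB : B.FG) :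
    ∃ C : Subgroup F, C.FG ∧ B.IsFreelyBelow C ∧ C.IsFreelyBelow A := by
  obtain ⟨hle, E, hEA, hBE, z, hz, hE⟩ := hBA
  let C := B ⊔ Subgroup.closure {z * y * z⁻¹}
  let D := B ⊔ Subgroup.closure {z * y * z⁻¹, z * (z * y * z⁻¹) * z⁻¹}
  have hCD : C ≤ D := sup_le_sup_left (Subgroup.closure_mono (by simp)) _
  have hBC : B ≤ C := le_sup_left
  have h1C : z * y * z⁻¹ ∈ C := Subgroup.mem_sup_right (Subgroup.subset_closure (by simp))
  have h2D : z * (z * y * z⁻¹) * z⁻¹ ∈ D :=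
    Subgroup.mem_sup_right (Subgroup.subset_closure (by simp))
  have hpow : ∀ {Q : Type} [Group Q] (q : Q), ∃ f : B →* Q, f ⟨y, hy⟩ = q := fun q =>
    ⟨(zpowersHom _ q).comp (e.comp B.subtype), by simp [he]⟩
  have key := fun {Q : Type} [Group Q] (f₀ f₁ f₂ : B →* Q) =>
    exists_hom_of_conj hBE hz hE hy f₀ f₁ f₂ (D := D) rfl
  have hDE : D ≤ E := (key (Q := Multiplicative ℤ) 1 1 1).1
  refine ⟨C, hB.sup ⟨{z * y * z⁻¹}, by simp⟩, ⟨hBC, C, le_rfl, hBC, z * y * z⁻¹, h1C, ?_⟩,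
    (hCD.trans hDE).trans hEA, D, hDE.trans hEA, hCD, _, h2D, ?_⟩
  · intro Q _ f q
    obtain ⟨f₁, hf₁⟩ := hpow q
    obtain ⟨-, h, h0, h1, -⟩ := key f f₁ 1
    exact ⟨h.comp (Subgroup.inclusion hCD), fun b hb hb' => h0 b hb (hCD hb'),
      (h1 (hCD h1C)).trans hf₁⟩
  · intro Q _ f q
    obtain ⟨f₁, hf₁⟩ := hpow (f ⟨z * y * z⁻¹, h1C⟩)
    obtain ⟨f₂, hf₂⟩ := hpow q
    obtain ⟨-, h, h0, h1, h2⟩ := key (f.comp (Subgroup.inclusion hBC)) f₁ f₂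
    refine ⟨h, fun c hc hc' => ?_, (h2 h2D).trans hf₂⟩
    have hle : C ≤ ((h.comp (Subgroup.inclusion hCD)).eqLocus f).map C.subtype := by
      refine sup_le (fun b hb => ⟨⟨b, hBC hb⟩, h0 b hb _, rfl⟩) ?_
      rw [Subgroup.closure_le]
      rintro _ rfl
      exact ⟨⟨_, h1C⟩, (h1 (hCD h1C)).trans hf₁, rfl⟩
    obtain ⟨⟨c', hc'⟩, heq, rfl⟩ := hle hc
    exact heq

end Subgroup.IsFreelyBelow

theorem FreeGroup.exists_rat_chain_subgroup : ∃ S : ℚ → Subgroup (FreeGroup (Fin 3)),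
    StrictMono S ∧ ∀ q, (S q).FG ∧ FreeGroup.of 0 ∈ S q ∧ FreeGroup.of 1 ∈ S q := by
  classical
  let α := {B : Subgroup (FreeGroup (Fin 3)) // B.FG ∧ FreeGroup.of 0 ∈ B ∧ FreeGroup.of 1 ∈ B}
  let r : α → α → Prop := fun B A => B.1.IsFreelyBelow A.1
  have : IsStrictOrder α r :=
    { irrefl := fun B h => h.lt.false
      trans := fun _ _ _ h h' => h.trans h' }
  let B₀ : Subgroup (FreeGroup (Fin 3)) := Subgroup.closure {FreeGroup.of 0, FreeGroup.of 1}
  have h0 : FreeGroup.of 0 ∈ B₀ := Subgroup.subset_closure (by simp)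
  have h1 : FreeGroup.of 1 ∈ B₀ := Subgroup.subset_closure (by simp)
  obtain ⟨f, hf⟩ := exists_rat_chain (r := r) (fun B A h => by
      obtain ⟨C, hC, hBC, hCA⟩ := h.exists_between B.2.2.1
        (e := FreeGroup.lift fun _ => Multiplicative.ofAdd 1) (by simp) B.2.1
      exact ⟨⟨C, hC, hBC.1 B.2.2.1, hBC.1 B.2.2.2⟩, hBC, hCA⟩)
    (a := ⟨B₀, ⟨{FreeGroup.of 0, FreeGroup.of 1}, by simp [B₀]⟩, h0, h1⟩)
    (b := ⟨⊤, Group.FG.out, trivial, trivial⟩) (by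
      refine ⟨le_top, ⊤, le_rfl, le_top, FreeGroup.of 2, trivial, fun Q _ f q => ?_⟩
      let g : FreeGroup (Fin 3) →* Q := FreeGroup.lift ![f ⟨_, h0⟩, f ⟨_, h1⟩, q]
      refine ⟨g.comp (Subgroup.subtype ⊤), fun b hb _ => ?_, by simp [g]⟩
      have hle : B₀ ≤ ((g.comp B₀.subtype).eqLocus f).map B₀.subtype := by
        rw [Subgroup.closure_le]
        rintro _ (rfl | rfl)
        · exact ⟨⟨_, h0⟩, show g (.of 0) = _ by simp [g], rfl⟩
        · exact ⟨⟨_, h1⟩, show g (.of 1) = _ by simp [g], rfl⟩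
      obtain ⟨⟨b', hb'⟩, heq, rfl⟩ := hle hb
      exact heq)
  exact ⟨fun q => (f q).1, fun p q hpq => (hf p q hpq).lt, fun q => (f q).2⟩

/-! ### Back-and-forth and the centralizers of free subgroups -/

theorem Subgroup.FG.map {G H : Type*} [Group G] [Group H] {S : Subgroup G} (hS : S.FG)
    (f : G →* H) : (S.map f).FG := by
  classical
  obtain ⟨T, rfl⟩ := hS
  exact ⟨T.image f, by rw [MonoidHom.map_closure, Finset.coe_image]⟩

theorem FreeGroup.eq_one_of_commute_of {α : Type*} {i j : α} (hij : i ≠ j) {w : FreeGroup α}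
    (hi : of i * w = w * of i) (hj : of j * w = w * of j) : w = 1 := by
  classical
  by_contra hw
  obtain ⟨l, L, hL⟩ := List.exists_cons_of_ne_nil (mt toWord_eq_nil_iff.1 hw)
  -- if the reduced word of `w` does not start with `k` or its inverse, then `k` cannot commute
  have key : ∀ k, k ≠ l.1 → of k * w ≠ w * of k := by
    intro k hk h
    have h1 : (of k * w).toWord = (k, true) :: l :: L := by
      have hred : IsReduced ((k, true) :: l :: L) :=
        isReduced_cons_cons.2 ⟨fun h => absurd h hk, hL ▸ isReduced_toWord⟩
      rw [toWord_mul, toWord_of, hL]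
      exact hred.reduce_eq
    have h2 := toWord_mul_sublist w (of k)
    rw [← h, h1, hL, toWord_of] at h2
    have h3 := h2.eq_of_length (by simp)
    simp only [List.cons_append, List.cons.injEq] at h3
    exact hk (congrArg Prod.fst h3.1)
  by_cases h : i = l.1
  · exact key j (fun h' => hij (h.trans h'.symm)) hj
  · exact key i h hi

/-- Isomorphic finitely generated subgroups are conjugate: any two embeddings in `G` of a finitely
generated group differ by an inner automorphism of `G`. -/
def IsConjHomogeneous (G : Type v) [Group G] : Prop :=
  ∀ (K : Type v) [Group K] [Group.FG K] (i j : K →* G), Function.Injective i →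
    Function.Injective j → ∃ t : G, ∀ k, t * i k * t⁻¹ = j k

/-- The subgroup `Γ` of `G × H` is the graph of an isomorphism between finitely generated subgroups
of `G` and `H`; the last two conditions say that the projections are injective on `Γ`. -/
structure IsPartialIso {G H : Type v} [Group G] [Group H] (Γ : Subgroup (G × H)) : Prop where
  fg : Γ.FG
  eq_one_right : ∀ h, (1, h) ∈ Γ → h = 1
  eq_one_left : ∀ g, (g, 1) ∈ Γ → g = 1

section BackAndForth

variable {G H : Type v} [Group G] [Group H]

theorem IsPartialIso.swap {Γ : Subgroup (G × H)} (hΓ : IsPartialIso Γ) :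
    IsPartialIso (Γ.map (MulEquiv.prodComm : G × H ≃* H × G).toMonoidHom) := by
  refine ⟨Subgroup.FG.map hΓ.fg _, ?_, ?_⟩
  · rintro g ⟨⟨g', h⟩, hm, heq⟩
    obtain ⟨rfl, rfl⟩ := Prod.mk.inj heq
    exact hΓ.eq_one_left _ hm
  · rintro h ⟨⟨g', h⟩, hm, heq⟩
    obtain ⟨rfl, rfl⟩ := Prod.mk.inj heq
    exact hΓ.eq_one_right _ hm

theorem IsPartialIso.exists_extension_left (hH : IsConjHomogeneous H)
    (hGH : ∀ K : Subgroup G, K.FG → ∃ φ : K →* H, Function.Injective φ)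
    {Γ : Subgroup (G × H)} (hΓ : IsPartialIso Γ) (g : G) :
    ∃ Γ', Γ ≤ Γ' ∧ IsPartialIso Γ' ∧ ∃ h, (g, h) ∈ Γ' := by
  let K : Subgroup G := Γ.map (MonoidHom.fst G H) ⊔ Subgroup.closure {g}
  have hK : K.FG := (Subgroup.FG.map hΓ.fg _).sup ⟨{g}, by simp⟩
  have hΓK : ∀ γ : Γ, γ.1.1 ∈ K := fun γ => Subgroup.mem_sup_left ⟨γ, γ.2, rfl⟩
  have hgK : g ∈ K := Subgroup.mem_sup_right (Subgroup.subset_closure rfl)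
  obtain ⟨φ, hφ⟩ := hGH K hK
  have := (Group.fg_iff_subgroup_fg _).2 hΓ.fg
  have := (Group.fg_iff_subgroup_fg _).2 hK
  obtain ⟨t, ht⟩ := hH Γ
    (φ.comp (((MonoidHom.fst G H).comp Γ.subtype).codRestrict K hΓK))
    ((MonoidHom.snd G H).comp Γ.subtype)
    ((injective_iff_map_eq_one _).2 fun γ hγ => by
      have h1 : γ.1.1 = 1 := congrArg Subtype.val ((map_eq_one_iff φ hφ).1 hγ)
      have h2 := hΓ.eq_one_right γ.1.2 (by rw [← h1]; exact γ.2)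
      exact Subtype.ext (Prod.ext h1 h2))
    ((injective_iff_map_eq_one _).2 fun γ hγ => by
      have h2 : γ.1.2 = 1 := hγ
      have h1 := hΓ.eq_one_left γ.1.1 (by rw [← h2]; exact γ.2)
      exact Subtype.ext (Prod.ext h1 h2))
  let θ : K →* G × H := K.subtype.prod ((MulAut.conj t).toMonoidHom.comp φ)
  have hθ : ∀ k, θ k = ((k : G), t * φ k * t⁻¹) := fun k => rfl
  refine ⟨θ.range, fun γ hγ => ⟨⟨γ.1, hΓK ⟨γ, hγ⟩⟩, ?_⟩, ⟨?_, ?_, ?_⟩, t * φ ⟨g, hgK⟩ * t⁻¹,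
    ⟨g, hgK⟩, rfl⟩
  · rw [hθ]
    exact Prod.ext rfl (ht ⟨γ, hγ⟩)
  · exact (Group.fg_iff_subgroup_fg _).1 (Group.fg_range θ)
  · rintro h ⟨k, hk⟩
    rw [hθ, Prod.mk.injEq] at hk
    obtain rfl : k = 1 := Subtype.ext hk.1
    simpa using hk.2.symm
  · rintro g ⟨k, hk⟩
    rw [hθ, Prod.mk.injEq] at hk
    have : φ k = 1 := by simpa using hk.2
    rw [← hk.1, (map_eq_one_iff φ hφ).1 this]
    rfl

theorem IsPartialIso.exists_extension_right (hG : IsConjHomogeneous G)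
    (hHG : ∀ K : Subgroup H, K.FG → ∃ φ : K →* G, Function.Injective φ)
    {Γ : Subgroup (G × H)} (hΓ : IsPartialIso Γ) (h : H) :
    ∃ Γ', Γ ≤ Γ' ∧ IsPartialIso Γ' ∧ ∃ g, (g, h) ∈ Γ' := by
  obtain ⟨Γ', hle, hΓ', g, hg⟩ := hΓ.swap.exists_extension_left hG hHG h
  refine ⟨Γ'.map (MulEquiv.prodComm : H × G ≃* G × H).toMonoidHom, fun γ hγ => ?_, hΓ'.swap, g,
    (h, g), hg, rfl⟩
  exact ⟨(γ.2, γ.1), hle ⟨γ, hγ, rfl⟩, rfl⟩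

/-- Two countable groups in which isomorphic finitely generated subgroups are conjugate are
isomorphic as soon as they have the same finitely generated subgroups up to isomorphism. -/
theorem IsConjHomogeneous.nonempty_mulEquiv [Countable G] [Countable H]
    (hG : IsConjHomogeneous G) (hH : IsConjHomogeneous H)
    (hGH : ∀ K : Subgroup G, K.FG → ∃ φ : K →* H, Function.Injective φ)
    (hHG : ∀ K : Subgroup H, K.FG → ∃ φ : K →* G, Function.Injective φ) : Nonempty (G ≃* H) := by
  obtain ⟨x, hx⟩ := exists_surjective_nat G
  obtain ⟨y, hy⟩ := exists_surjective_nat H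
  have hstep : ∀ (n : ℕ) (Γ : {Γ : Subgroup (G × H) // IsPartialIso Γ}),
      ∃ Γ' : {Γ : Subgroup (G × H) // IsPartialIso Γ}, Γ.1 ≤ Γ'.1 ∧
        (∃ h, (x n, h) ∈ Γ'.1) ∧ ∃ g, (g, y n) ∈ Γ'.1 := by
    rintro n ⟨Γ, hΓ⟩
    obtain ⟨Γ', hle, hΓ', h, hh⟩ := hΓ.exists_extension_left hH hGH (x n)
    obtain ⟨Γ'', hle', hΓ'', hg⟩ := hΓ'.exists_extension_right hG hHG (y n)
    exact ⟨⟨Γ'', hΓ''⟩, hle.trans hle', ⟨h, hle' hh⟩, hg⟩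
  choose next hle hnx hny using hstep
  let Γ : ℕ → {Γ : Subgroup (G × H) // IsPartialIso Γ} := fun n =>
    Nat.rec ⟨⊥, ⟨∅, by simp⟩, fun h hh => congrArg Prod.snd (Subgroup.mem_bot.1 hh),
      fun g hg => congrArg Prod.fst (Subgroup.mem_bot.1 hg)⟩ next n
  have hmono : Monotone fun n => (Γ n).1 := monotone_nat_of_le_succ fun n => hle n (Γ n)
  let S : Subgroup (G × H) := ⨆ n, (Γ n).1
  have hS : ∀ p, p ∈ S ↔ ∃ n, p ∈ (Γ n).1 := fun p =>
    Subgroup.mem_iSup_of_directed hmono.directed_le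
  let p : S →* G := (MonoidHom.fst G H).comp S.subtype
  let q : S →* H := (MonoidHom.snd G H).comp S.subtype
  have hp : Function.Bijective p := by
    refine ⟨(injective_iff_map_eq_one _).2 fun s hs => ?_, fun g => ?_⟩
    · have h1 : s.1.1 = 1 := hs
      obtain ⟨n, hn⟩ := (hS s).1 s.2
      exact Subtype.ext (Prod.ext h1 ((Γ n).2.eq_one_right _ (by rw [← h1]; exact hn)))
    · obtain ⟨n, rfl⟩ := hx g
      obtain ⟨h, hh⟩ := hnx n (Γ n)
      exact ⟨⟨(x n, h), (hS _).2 ⟨n + 1, hh⟩⟩, rfl⟩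
  have hq : Function.Bijective q := by
    refine ⟨(injective_iff_map_eq_one _).2 fun s hs => ?_, fun h => ?_⟩
    · have h2 : s.1.2 = 1 := hs
      obtain ⟨n, hn⟩ := (hS s).1 s.2
      exact Subtype.ext (Prod.ext ((Γ n).2.eq_one_left _ (by rw [← h2]; exact hn)) h2)
    · obtain ⟨n, rfl⟩ := hy h
      obtain ⟨g, hg⟩ := hny n (Γ n)
      exact ⟨⟨(g, y n), (hS _).2 ⟨n + 1, hg⟩⟩, rfl⟩
  exact ⟨(MulEquiv.ofBijective p hp).symm.trans (MulEquiv.ofBijective q hq)⟩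

end BackAndForth

theorem IsAlephNullExistentiallyClosed.isConjHomogeneous {G : Type v} [Group G]
    (hG : IsAlephNullExistentiallyClosed G) : IsConjHomogeneous G :=
  fun _ _ _ _ _ hi hj => hG.exists_conj hi hj

/-- The centralizer of a finitely generated subgroup `A` with trivial center inherits homogeneity:
together with `A`, an embedding of `K` in the centralizer is an embedding of `A × K`. -/
theorem IsConjHomogeneous.centralizer {G : Type v} [Group G] (hG : IsConjHomogeneous G)
    {A : Subgroup G} (hA : A.FG) (hA' : ∀ a ∈ A, a ∈ Subgroup.centralizer (A : Set G) → a = 1) :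
    IsConjHomogeneous (Subgroup.centralizer (A : Set G)) := by
  intro K _ _ i j hi hj
  have hcomm : ∀ (f : K →* Subgroup.centralizer (A : Set G)) (a : A) (k : K),
      Commute (A.subtype a) ((Subgroup.subtype _).comp f k) := fun f a k =>
    Subgroup.mem_centralizer_iff.1 (f k).2 a a.2
  have hinj : ∀ f : K →* Subgroup.centralizer (A : Set G), Function.Injective f →
      Function.Injective (A.subtype.noncommCoprod ((Subgroup.subtype _).comp f) (hcomm f)) := by
    refine fun f hf => (injective_iff_map_eq_one _).2 ?_
    rintro ⟨a, k⟩ h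
    have h' : (a : G) * f k = 1 := h
    have hk : (a : G) = ((f k)⁻¹ : Subgroup.centralizer (A : Set G)) := eq_inv_of_mul_eq_one_left h'
    have ha : (a : G) = 1 := hA' a a.2 (hk ▸ ((f k)⁻¹).2)
    rw [ha, one_mul] at h'
    exact Prod.ext (Subtype.ext ha) ((map_eq_one_iff f hf).1 (Subtype.ext h'))
  have := (Group.fg_iff_subgroup_fg _).2 hA
  have : Group.FG (A × K) := inferInstance
  obtain ⟨t, ht⟩ := hG (A × K) _ _ (hinj i hi) (hinj j hj)
  refine ⟨⟨t, ?_⟩, fun k => Subtype.ext ?_⟩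
  · rw [Subgroup.mem_centralizer_iff]
    intro a ha
    have := ht (⟨a, ha⟩, 1)
    simp only [MonoidHom.noncommCoprod_apply, map_one, mul_one] at this
    exact (mul_inv_eq_iff_eq_mul.1 this).symm
  · simpa using ht (1, k)

theorem IsAlephNullExistentiallyClosed.nonempty_centralizer_mulEquiv {G : Type v} [Group G]
    [Countable G] (hG : IsAlephNullExistentiallyClosed G) {κ : Type} [Finite κ]
    {ψ : FreeGroup κ →* G} (hψ : Function.Injective ψ) {S : Subgroup (FreeGroup κ)} (hS : S.FG)
    {i j : κ} (hij : i ≠ j) (hi : FreeGroup.of i ∈ S) (hj : FreeGroup.of j ∈ S) :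
    Nonempty (Subgroup.centralizer (S.map ψ : Set G) ≃* G) := by
  have : Nonempty κ := ⟨i⟩
  refine (hG.isConjHomogeneous.centralizer (Subgroup.FG.map hS ψ) ?_).nonempty_mulEquiv hG.isConjHomogeneous
    (fun K _ => ⟨(Subgroup.subtype _).comp K.subtype,
      (Subgroup.subtype_injective _).comp K.subtype_injective⟩) fun K hK => ?_
  · rintro _ ⟨w, hw, rfl⟩ hc
    have h : ∀ k, FreeGroup.of k ∈ S → FreeGroup.of k * w = w * FreeGroup.of k := fun k hk =>
      hψ (by
        rw [map_mul, map_mul]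
        exact Subgroup.mem_centralizer_iff.1 hc _ ⟨_, hk, rfl⟩)
    rw [FreeGroup.eq_one_of_commute_of hij (h i hi) (h j hj), map_one]
  · obtain ⟨ψ', hψ', hcomm⟩ := hG.exists_freeGroup_commute κ hK
    obtain ⟨t, ht⟩ := hG.exists_conj hψ' hψ
    refine ⟨((MulAut.conj t).toMonoidHom.comp K.subtype).codRestrict _ fun k => ?_,
      fun k k' h => ?_⟩
    · rw [Subgroup.mem_centralizer_iff]
      rintro _ ⟨w, -, rfl⟩
      change ψ w * (t * k * t⁻¹) = t * k * t⁻¹ * ψ w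
      rw [← ht w]
      have := hcomm k k.2 w
      calc t * ψ' w * t⁻¹ * (t * k * t⁻¹) = t * (ψ' w * k) * t⁻¹ := by group
        _ = t * k * t⁻¹ * (t * ψ' w * t⁻¹) := by rw [← this]; group
    · exact Subtype.ext ((MulAut.conj t).injective (congrArg Subtype.val h))

/-- The centralizers of the images of a chain of subgroups of a free group form a chain of copies
of `G`. -/
theorem IsAlephNullExistentiallyClosed.exists_rat_chain_centralizer {G : Type v} [Group G]
    [Countable G] (hG : IsAlephNullExistentiallyClosed G) : ∃ A : ℚ → Subgroup G,
      (∀ q, (A q).FG ∧ IsFreeGroup (A q) ∧ ∃ x ∈ A q, ∃ y ∈ A q, x * y ≠ y * x) ∧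
      (∀ q r, Subgroup.centralizer (A q : Set G) ≤ Subgroup.centralizer (A r : Set G) ↔ q ≤ r) ∧
      ∀ q, Nonempty (Subgroup.centralizer (A q : Set G) ≃* G) := by
  obtain ⟨S, hS, hS'⟩ := FreeGroup.exists_rat_chain_subgroup
  obtain ⟨ψ, hψ, -⟩ := hG.exists_freeGroup_commute (Fin 3) (B := ⊥) ⟨∅, by simp⟩
  have hne : ∀ i : Fin 3, ψ (FreeGroup.of i) ≠ 1 := fun i =>
    (map_ne_one_iff ψ hψ).2 (FreeGroup.of_ne_one i)
  refine ⟨fun q => (S (-q)).map ψ, fun q => ⟨Subgroup.FG.map (hS' _).1 ψ, ?_, ?_⟩, fun q r => ?_, fun q => ?_⟩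
  · exact IsFreeGroup.ofMulEquiv ((S (-q)).equivMapOfInjective ψ hψ)
  · refine ⟨_, ⟨_, (hS' _).2.1, rfl⟩, _, ⟨_, (hS' _).2.2, rfl⟩, fun h => ?_⟩
    rw [← map_mul, ← map_mul] at h
    have := hψ h
    exact absurd this (by decide)
  · rw [hG.centralizer_le_iff (Subgroup.FG.map (hS' _).1 ψ) ?_, Subgroup.map_le_map_iff_of_injective hψ,
      hS.le_iff_le, neg_le_neg_iff]
    intro h
    exact hne 0 (Subgroup.mem_bot.1 (h ▸ ⟨_, (hS' (-q)).2.1, rfl⟩))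
  · exact hG.nonempty_centralizer_mulEquiv hψ (hS' _).1 (by decide) (hS' _).2.1 (hS' _).2.2

theorem proposition3p1 :
    ((∃ (H : Type u) (_ : Group H), ¬ IsSofic H) →
      ∃ (G : Type v) (_ : Group G),
        Countable G ∧ IsAlephNullExistentiallyClosed G ∧ ¬ IsSofic G) ∧
    (∀ (G : Type v) [Group G], Countable G → IsAlephNullExistentiallyClosed G → ¬ IsSofic G →
      (∃ A : ℚ → Subgroup G,
        (∀ q, (A q).FG ∧ IsFreeGroup (A q) ∧ ∃ x ∈ A q, ∃ y ∈ A q, x * y ≠ y * x) ∧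
        (∀ q r, Subgroup.centralizer (A q : Set G) ≤ Subgroup.centralizer (A r : Set G) ↔ q ≤ r) ∧
        (∀ q, Nonempty (Subgroup.centralizer (A q : Set G) ≃* G)) ∧
        (∀ q, ¬ IsSofic (Subgroup.centralizer (A q : Set G)))) ∧
      IsOmegaNonSofic G) := by
  refine ⟨fun ⟨H, _, hH⟩ => exists_countable_isAlephNullExistentiallyClosed_not_isSofic H hH,
    fun G _ _ hG hns => ?_⟩
  obtain ⟨A, hA, hle, hiso⟩ := hG.exists_rat_chain_centralizer
  have hC : ∀ q, ¬ IsSofic (Subgroup.centralizer (A q : Set G)) := fun q hq =>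
    let ⟨e⟩ := hiso q
    hns (hq.of_injective e.symm.toMonoidHom e.symm.injective)
  refine ⟨⟨A, hA, hle, hiso, hC⟩, hns, fun n => Subgroup.centralizer (A (-n) : Set G), ?_,
    fun n => hC _⟩
  intro m n hmn
  refine lt_of_le_not_ge ((hle _ _).2 ?_) fun h => ?_
  · exact neg_le_neg (by exact_mod_cast hmn.le)
  · have := (hle _ _).1 h
    rw [neg_le_neg_iff] at this
    exact absurd hmn (not_lt.2 (by exact_mod_cast this))
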